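/- Let $\mathbb{D}=\{z\in\mathbb{C}:|z|<1\}$, let $\mathcal{B}$ be the class of analytic functions $f(z)=\sum_{n\ge 0}a_nz^n$ on $\mathbb{D}$ with $|f|\le 1$ on $\mathbb D$, and for an integer $m\ge 1$ let $\mathcal{B}_m$ be the class of $\omega\in\mathcal{B}$ with $\omega(0)=\omega'(0)=\cdots=\omega^{(m-1)}(0)=0$ and $\omega^{(m)}(0)\neq 0$. For an analytic function $g(z)=\sum_{n\ge0} b_nz^n$ on $\mathbb{D}$ put $$\mathcal{C}g(z)=\sum_{n=0}^\infty\frac{1}{n+1}\Big(\sum_{k=0}^n b_k\Big)z^n ,\qquad\text{and let}\qquad \phi_k(r)=\sum_{i=k}^\infty\frac{r^i}{i+1}\quad(0\le r<1).$$ For every integer $m\ge1$ the equation $$2\left(-r^m-\log(1-r^m)\right)=r^m\left(1-r^{2m}\right)$$ has a unique root $R_m\in(0,1)$, the equation $\Phi_m(r)=0$, where $$\Phi_m(r)=\frac{-r^m-\log(1-r^m)}{2r^m}\left\{-\frac{\log(1-r^m)}{r^m}+\frac{\log(1+r^m)}{r^m}+\frac{2}{1+r^m}\right\}+2\left(\frac{r^2}{1-r}+r+2+\frac{2}{r}\log(1-r)\right)-\frac{\log(1+r^m)}{r^m},$$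 has a unique root $R_{m,1}\in(0,1)$, and $R_{m,1}\le R_m$. If $f(z)=\sum_{n\ge 0}a_nz^n$ belongs to $\mathcal{B}$ and $\omega\in\mathcal{B}_m$, then $$|\mathcal{C}f(\omega(z))|+|\mathcal{C}f'(\omega(z))|\,\phi_1(r^m)+\sum_{k=2}^\infty|a_k|\,\phi_k(r)\le\frac{1}{r^m}\log\frac{1}{1-r^m}\qquad\text{for } |z|=r\le R_{m,1},$$ where $\mathcal{C}f'$ means $\mathcal{C}$ applied to $f'$, all the series converge, and the right-hand side is read as its limit $1$ when $r=0$. The number $R_{m,1}$ is best possible: for every $r\in(R_{m,1},1)$ there is $a_0\in(0,1)$ such that for all $a\in(a_0,1)$ the functions $f(z)=(a+z)/(1+az)\in\mathcal{B}$ and $\omega(z)=z^m\in\mathcal{B}_m$ violate the inequality at $z=r$. -/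

import Mathlib

noncomputable section

namespace CesaroBohr

/-- The open unit disk. -/
def unitDisk : Set ℂ := Metric.ball (0 : ℂ) 1

/-- The class `𝓑` of analytic functions on the unit disk that are bounded by one there. -/
def ClassB (f : ℂ → ℂ) : Prop :=
  DifferentiableOn ℂ f unitDisk ∧ ∀ z ∈ unitDisk, ‖f z‖ ≤ 1

/-- The class `𝓑_m`: members of `𝓑` whose zero at the origin has order exactly `m`. -/
def ClassBm (m : ℕ) (ω : ℂ → ℂ) : Prop :=
  ClassB ω ∧ (∀ k < m, iteratedDeriv k ω 0 = 0) ∧ iteratedDeriv m ω 0 ≠ 0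

/-- The coefficient `a_n` in the expansion `f(z) = ∑ a_n z ^ n` about the origin. -/
def coeff (f : ℂ → ℂ) (n : ℕ) : ℂ := iteratedDeriv n f 0 / (n.factorial : ℂ)

/-- The `n`-th term `(1 / (n + 1)) (a_0 + ⋯ + a_n) z ^ n` of the Cesàro transform. -/
def cesaroTerm (f : ℂ → ℂ) (z : ℂ) (n : ℕ) : ℂ :=
  1 / ((n : ℂ) + 1) * (∑ k ∈ Finset.range (n + 1), coeff f k) * z ^ n

/-- The Cesàro operator. -/
def cesaro (f : ℂ → ℂ) (z : ℂ) : ℂ := ∑' n : ℕ, cesaroTerm f z n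

/-- `φ_k(r) = ∑_{i ≥ k} r ^ i / (i + 1)`, with `i = k + j`. -/
def phi (k : ℕ) (r : ℝ) : ℝ := ∑' j : ℕ, r ^ (k + j) / (((k + j : ℕ) : ℝ) + 1)

/-- The left-hand side `|Cf(ω(z))| + |Cf'(ω(z))| φ_1(r ^ m) + ∑_{k ≥ 2} |a_k| φ_k(r)`
with `r = |z|`. -/
def bohrSum (m : ℕ) (f ω : ℂ → ℂ) (z : ℂ) : ℝ :=
  ‖cesaro f (ω z)‖ + ‖cesaro (deriv f) (ω z)‖ * phi 1 (‖z‖ ^ m)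
    + ∑' k : ℕ, ‖coeff f (k + 2)‖ * phi (k + 2) ‖z‖

/-- `(1 / x) log (1 / (1 - x))`, with its limit `1` as the value at `x = 0`. -/
def logBound (x : ℝ) : ℝ := if x = 0 then 1 else 1 / x * Real.log (1 / (1 - x))

/-- The equation `2 (-r ^ m - log (1 - r ^ m)) = r ^ m (1 - r ^ (2 m))`. -/
def RmEquation (m : ℕ) (r : ℝ) : Prop :=
  2 * (-r ^ m - Real.log (1 - r ^ m)) = r ^ m * (1 - r ^ (2 * m))

/-- The function `Φ_m`. -/
def Phi (m : ℕ) (r : ℝ) : ℝ :=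
  (-r ^ m - Real.log (1 - r ^ m)) / (2 * r ^ m) *
      (-(1 / r ^ m) * Real.log (1 - r ^ m) + 1 / r ^ m * Real.log (1 + r ^ m)
        + 2 / (1 + r ^ m))
    + 2 * (r ^ 2 / (1 - r) + r + 2 + 2 / r * Real.log (1 - r))
    - 1 / r ^ m * Real.log (1 + r ^ m)

/-- The disk automorphism `z ↦ (a + z) / (1 + a z)`. -/
def moebius (a : ℝ) (z : ℂ) : ℂ := ((a : ℂ) + z) / (1 + (a : ℂ) * z)

end CesaroBohr

end

namespace CesaroBohr

open Filter Topology Asymptotics Set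
open scoped ComplexConjugate

/-! The Cesàro transform is an average along a radius: `C g(w) = ∫₀¹ g(t w) / (1 - t w) dt`. The
problem therefore reduces to a pointwise estimate.

Put `A = |f(0)|`, `F = |f(t w)|`, `x = r ^ m` and `s = t x`; Schwarz's lemma gives `|ω(z)| ≤ x`.
Schwarz–Pick bounds `|f'(t w)|` by `(1 - F²) / (1 - |t w|²)`, so the integrand is controlled by `F +
φ (1 - F²) / (1 - s²)` with `φ = φ₁(x)`. This increases in `F ≤ 1` as long as `2 φ ≤ 1 - s²`, which
is the inequality behind `R_m`. Hence `F` may be replaced by its largest value `(A + s) / (1 + A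
s)`. The result is `1 / (1 - s)` plus `1 - A` times a bracket that is largest at `A = 1`
(`integrand_le`).

Integrating, and using `|a_k| ≤ 1 - A² ≤ 2 (1 - A)` for the tail, bounds the left-hand side by the
right-hand side plus `(1 - A) Φ_m(r)`. Since `Φ_m` is strictly increasing (`Phi_strictMono`), the
error is nonpositive exactly up to its root. The root lies below `R_m` because `Φ_m(R_m) > 0`
(`Phi_pos_of_two_mul_phi_one_eq`), so the monotonicity in `F` is available throughout.

For the Möbius functions with `a → 1` every loss is `o(1 - a)`: the excess is at least `(1 - a)
(Φ_m(r) + o(1))`, which is positive beyond the root. -/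

/-! ### Schwarz–Pick, growth and coefficient estimates for bounded functions -/

lemma normSq_one_sub_conj_mul (u v : ℂ) :
    ‖1 - conj v * u‖ ^ 2 - ‖u - v‖ ^ 2 = (1 - ‖u‖ ^ 2) * (1 - ‖v‖ ^ 2) := by
  simp only [← Complex.normSq_eq_norm_sq, Complex.normSq_apply]
  simp
  ring

lemma norm_sub_le_norm_one_sub_conj_mul {u v : ℂ} (hu : ‖u‖ ≤ 1) (hv : ‖v‖ ≤ 1) :
    ‖u - v‖ ≤ ‖1 - conj v * u‖ := by
  have h := normSq_one_sub_conj_mul u v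
  have h1 : 0 ≤ (1 - ‖u‖ ^ 2) * (1 - ‖v‖ ^ 2) := by
    apply mul_nonneg <;> nlinarith [norm_nonneg u, norm_nonneg v]
  exact le_of_sq_le_sq (by linarith) (norm_nonneg _) 

lemma zero_mem_unitDisk : (0 : ℂ) ∈ unitDisk := by simp [unitDisk]

lemma mem_unitDisk {z : ℂ} : z ∈ unitDisk ↔ ‖z‖ < 1 := by simp [unitDisk]

lemma isOpen_unitDisk : IsOpen unitDisk := Metric.isOpen_ball

/-- Schwarz–Pick estimate at the origin for a bounded function whose expansion, after the constant
term, starts at order `n + 1`. -/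
lemma ClassB.norm_sub_le_pow_mul {f : ℂ → ℂ} (hf : ClassB f) {n : ℕ}
    (hn : (fun z => f z - f 0) =o[𝓝 0] fun z : ℂ => ‖z‖ ^ n) {z : ℂ} (hz : z ∈ unitDisk) :
    ‖f z - f 0‖ ≤ ‖z‖ ^ (n + 1) * ‖1 - conj (f 0) * f z‖ := by
  -- The denominator `1 - conj (f 0) * f w` vanishes when `f` is a unimodular constant. Scaling `f`
  -- by `c < 1` keeps it at least `1 - c²`; at the end `c → 1`.
  have hden : ∀ c ∈ Ioo (0 : ℝ) 1, ∀ w ∈ unitDisk,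
      1 - c ^ 2 ≤ ‖1 - conj ((c : ℂ) * f 0) * ((c : ℂ) * f w)‖ := by
    intro c hc w hw
    have h1 : ‖conj ((c : ℂ) * f 0) * ((c : ℂ) * f w)‖ ≤ c ^ 2 := by
      simp only [norm_mul, RCLike.norm_conj, Complex.norm_real, Real.norm_eq_abs,
        abs_of_pos hc.1]
      have := mul_le_mul (hf.2 0 zero_mem_unitDisk) (hf.2 w hw) (norm_nonneg _) zero_le_one
      nlinarith [hc.1, sq_nonneg c]
    have := norm_sub_norm_le (1 : ℂ) (conj ((c : ℂ) * f 0) * ((c : ℂ) * f w))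
    rw [norm_one] at this
    linarith
  have key : ∀ c ∈ Ioo (0 : ℝ) 1,
      ‖(c : ℂ) * f z - c * f 0‖ ≤
        ‖z‖ ^ (n + 1) * ‖1 - conj ((c : ℂ) * f 0) * ((c : ℂ) * f z)‖ := by
    intro c hc
    have hc2 : 0 < 1 - c ^ 2 := by nlinarith [hc.1, hc.2]
    have hle : ∀ w ∈ unitDisk, ‖(c : ℂ) * f w‖ ≤ 1 := fun w hw => by
      rw [norm_mul, Complex.norm_real, Real.norm_eq_abs, abs_of_pos hc.1]
      nlinarith [hf.2 w hw, norm_nonneg (f w), hc.1, hc.2]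
    have hpos : ∀ w ∈ unitDisk, 0 < ‖1 - conj ((c : ℂ) * f 0) * ((c : ℂ) * f w)‖ :=
      fun w hw => hc2.trans_le (hden c hc w hw)
    set T : ℂ → ℂ := fun w =>
      (c * f w - c * f 0) / (1 - conj ((c : ℂ) * f 0) * ((c : ℂ) * f w)) with hT
    have hT0 : T 0 = 0 := by simp [hT]
    have hTd : DifferentiableOn ℂ T unitDisk := by
      refine DifferentiableOn.div ?_ ?_ fun w hw => norm_pos_iff.1 (hpos w hw)
      · exact (hf.1.const_mul _).sub_const _
      · exact ((hf.1.const_mul _).const_mul _).const_sub _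
    have hTm : MapsTo T unitDisk (Metric.closedBall (T 0) 1) := by
      intro w hw
      rw [hT0, mem_closedBall_zero_iff, norm_div, div_le_one (hpos w hw)]
      exact norm_sub_le_norm_one_sub_conj_mul (hle w hw) (hle 0 zero_mem_unitDisk)
    have hTo : (fun w => T w - T 0) =o[𝓝 0] fun w : ℂ => ‖w - 0‖ ^ n := by
      simp only [hT0, sub_zero]
      refine IsBigO.trans_isLittleO (IsBigO.of_bound (1 / (1 - c ^ 2)) ?_) hn
      filter_upwards [isOpen_unitDisk.mem_nhds zero_mem_unitDisk] with w hw
      rw [hT, norm_div, ← mul_sub, norm_mul, Complex.norm_real, Real.norm_eq_abs,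
        abs_of_pos hc.1, div_mul_eq_mul_div, one_mul]
      exact div_le_div₀ (norm_nonneg _)
        (mul_le_of_le_one_left (norm_nonneg _) hc.2.le) hc2 (hden c hc w hw)
    have h := Complex.dist_le_mul_div_pow_of_mapsTo_ball_of_isLittleO hTd hTm hTo hz
    rw [dist_eq_norm, hT0, sub_zero, dist_zero_right, div_one, one_mul, hT, norm_div,
      div_le_iff₀ (hpos z hz)] at h
    exact h
  have hlim1 : Tendsto (fun c : ℝ => ‖(c : ℂ) * f z - c * f 0‖) (𝓝[<] 1) (𝓝 ‖f z - f 0‖) := by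
    have : Continuous fun c : ℝ => ‖(c : ℂ) * f z - c * f 0‖ := by fun_prop
    simpa using (this.tendsto 1).mono_left nhdsWithin_le_nhds
  have hlim2 : Tendsto (fun c : ℝ => ‖z‖ ^ (n + 1) *
      ‖1 - conj ((c : ℂ) * f 0) * ((c : ℂ) * f z)‖) (𝓝[<] 1)
      (𝓝 (‖z‖ ^ (n + 1) * ‖1 - conj (f 0) * f z‖)) := by
    have : Continuous fun c : ℝ => ‖z‖ ^ (n + 1) *
        ‖1 - conj ((c : ℂ) * f 0) * ((c : ℂ) * f z)‖ := by fun_prop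
    simpa using (this.tendsto 1).mono_left nhdsWithin_le_nhds
  refine le_of_tendsto_of_tendsto hlim1 hlim2 ?_
  filter_upwards [Ioo_mem_nhdsLT (zero_lt_one' ℝ)] with c hc using key c hc

lemma isBigO_sub_sum_coeff {f : ℂ → ℂ} (hf : AnalyticAt ℂ f 0) (n : ℕ) :
    (fun z => f z - ∑ k ∈ Finset.range n, coeff f k * z ^ k) =O[𝓝 0] fun z : ℂ => ‖z‖ ^ n := by
  have h := hf.hasFPowerSeriesAt.isBigO_sub_partialSum_pow n
  simpa [FormalMultilinearSeries.partialSum, coeff, mul_comm] using h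

lemma analyticAt_zero {f : ℂ → ℂ} (hf : DifferentiableOn ℂ f unitDisk) : AnalyticAt ℂ f 0 :=
  hf.analyticAt (isOpen_unitDisk.mem_nhds zero_mem_unitDisk)

lemma coeff_zero (f : ℂ → ℂ) : coeff f 0 = f 0 := by simp [coeff]

lemma coeff_one (f : ℂ → ℂ) : coeff f 1 = deriv f 0 := by simp [coeff, iteratedDeriv_one]

/-- Schwarz's lemma for a zero of order `m`. -/
lemma ClassBm.norm_le_pow {m : ℕ} (hm : 1 ≤ m) {ω : ℂ → ℂ} (hω : ClassBm m ω) {z : ℂ}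
    (hz : z ∈ unitDisk) : ‖ω z‖ ≤ ‖z‖ ^ m := by
  obtain ⟨n, rfl⟩ : ∃ n, m = n + 1 := ⟨m - 1, by omega⟩
  have h0 : ω 0 = 0 := by simpa using hω.2.1 0 (by omega)
  have hO := isBigO_sub_sum_coeff (analyticAt_zero hω.1.1) (n + 1)
  have hs : ∀ w : ℂ, ∑ k ∈ Finset.range (n + 1), coeff ω k * w ^ k = 0 := fun w =>
    Finset.sum_eq_zero fun k hk => by simp [coeff, hω.2.1 k (Finset.mem_range.1 hk)]
  simp only [hs, sub_zero] at hO
  have := hω.1.norm_sub_le_pow_mul (n := n) (by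
    simpa [h0] using hO.trans_isLittleO (isLittleO_norm_pow_norm_pow (Nat.lt_succ_self n))) hz
  simpa [h0] using this

/-- Wiener's bound for the coefficients of a bounded function. -/
lemma ClassB.norm_coeff_le {f : ℂ → ℂ} (hf : ClassB f) {n : ℕ} (hn : 1 ≤ n) :
    ‖coeff f n‖ ≤ 1 - ‖f 0‖ ^ 2 := by
  obtain ⟨p, rfl⟩ : ∃ p, n = p + 1 := ⟨n - 1, by omega⟩
  set N := p + 1 with hN
  have hN0 : (N : ℂ) ≠ 0 := by rw [hN]; exact_mod_cast Nat.succ_ne_zero p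
  set ζ : ℂ := Complex.exp (2 * Real.pi * Complex.I / N)
  have hζ : IsPrimitiveRoot ζ N := Complex.isPrimitiveRoot_exp N (by omega)
  have hζn : ‖ζ‖ = 1 := hζ.norm'_eq_one (by omega)
  have hnorm : ∀ (j : ℕ) (z : ℂ), ‖ζ ^ j * z‖ = ‖z‖ := fun j z => by simp [hζn]
  -- Averaging over the `N`-th roots of unity kills every coefficient whose index is not a multiple
  -- of `N`, so `g = f(0) + a_N z ^ N + ⋯` stays bounded by one. Schwarz–Pick of order `N`, divided
  -- by `z ^ N` as `z → 0`, then bounds `a_N`.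
  set g : ℂ → ℂ := fun z => (N : ℂ)⁻¹ * ∑ j ∈ Finset.range N, f (ζ ^ j * z) with hg
  have hg0 : g 0 = f 0 := by simp [hg, hN0]
  have hgB : ClassB g := by
    constructor
    · refine DifferentiableOn.const_mul (DifferentiableOn.fun_sum fun j _ => ?_) _
      refine hf.1.comp (by fun_prop) fun z hz => ?_
      rw [mem_unitDisk] at hz ⊢
      rwa [hnorm]
    · intro z hz
      rw [hg, norm_mul, norm_inv, Complex.norm_natCast, inv_mul_le_one₀ (by positivity)]
      refine (norm_sum_le _ _).trans ?_
      refine (Finset.sum_le_sum (g := fun _ => (1 : ℝ)) fun j _ => hf.2 _ ?_).trans (by simp)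
      rw [mem_unitDisk] at hz ⊢
      rwa [hnorm]
  have hO : (fun z => g z - (f 0 + coeff f N * z ^ N)) =O[𝓝 0] fun z : ℂ => ‖z‖ ^ (N + 1) := by
    have h1 : ∀ j ∈ Finset.range N, (fun z => f (ζ ^ j * z) -
        ∑ k ∈ Finset.range (N + 1), coeff f k * (ζ ^ j * z) ^ k) =O[𝓝 0]
          fun z : ℂ => ‖z‖ ^ (N + 1) := by
      intro j _
      have ht : Tendsto (fun z : ℂ => ζ ^ j * z) (𝓝 0) (𝓝 0) := by
        simpa using (continuous_const_mul (ζ ^ j)).tendsto (0 : ℂ)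
      simpa [Function.comp_def, hζn] using
        (isBigO_sub_sum_coeff (analyticAt_zero hf.1) (N + 1)).comp_tendsto ht
    have h2 := (IsBigO.fun_sum h1).const_mul_left (N : ℂ)⁻¹
    refine h2.congr_left fun z => ?_
    rw [Finset.sum_sub_distrib, mul_sub]
    congr 1
    rw [Finset.sum_comm]
    have h3 : ∀ k ∈ Finset.range (N + 1), k ≠ 0 → k ≠ N →
        ∑ j ∈ Finset.range N, coeff f k * (ζ ^ j * z) ^ k = 0 := by
      intro k hk hk0 hkN
      have hne : ζ ^ k ≠ 1 := hζ.pow_ne_one_of_pos_of_lt hk0 (by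
        have := Finset.mem_range.1 hk; omega)
      have hgs : ∑ j ∈ Finset.range N, (ζ ^ k) ^ j = 0 := by
        have := mul_geom_sum (ζ ^ k) N
        rw [← pow_mul, mul_comm k N, pow_mul, hζ.pow_eq_one, one_pow, sub_self] at this
        exact (mul_eq_zero.1 this).resolve_left (sub_ne_zero.2 hne)
      calc ∑ j ∈ Finset.range N, coeff f k * (ζ ^ j * z) ^ k
          = coeff f k * z ^ k * ∑ j ∈ Finset.range N, (ζ ^ k) ^ j := by
            rw [Finset.mul_sum]
            refine Finset.sum_congr rfl fun j _ => ?_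
            rw [mul_pow, ← pow_mul, ← pow_mul, mul_comm j k]; ring
        _ = 0 := by rw [hgs, mul_zero]
    rw [Finset.sum_range_succ, Finset.sum_eq_single_of_mem 0 (by simp [hN])
      fun k hk hk0 => h3 k (by simp at hk ⊢; omega) hk0 (by simp at hk; omega)]
    have h4 : ∀ j, (ζ ^ j * z) ^ N = z ^ N := fun j => by
      rw [mul_pow, ← pow_mul, mul_comm j N, pow_mul, hζ.pow_eq_one, one_pow, one_mul]
    simp only [h4, pow_zero, mul_one, Finset.sum_const, Finset.card_range, nsmul_eq_mul,
      coeff_zero]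
    field_simp
  have hO' : (fun z => g z - g 0) =o[𝓝 0] fun z : ℂ => ‖z‖ ^ p := by
    have h1 := hO.trans_isLittleO
      (isLittleO_norm_pow_norm_pow (E' := ℂ) (show p < N + 1 by omega))
    have h2 : (fun z : ℂ => coeff f N * z ^ N) =o[𝓝 0] fun z : ℂ => ‖z‖ ^ p := by
      refine IsLittleO.const_mul_left ?_ _
      exact (isLittleO_pow_pow (𝕜 := ℂ) (show p < N by omega)).trans_isBigO
        (IsBigO.of_norm_le (by simp))
    exact (h1.add h2).congr_left fun z => by rw [hg0]; ring
  have hb : ∀ᶠ z in 𝓝[≠] (0 : ℂ), ‖(g z - g 0) / z ^ N‖ ≤ ‖1 - conj (g 0) * g z‖ := by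
    filter_upwards [nhdsWithin_le_nhds (isOpen_unitDisk.mem_nhds zero_mem_unitDisk),
      self_mem_nhdsWithin] with z hz hz0
    have hzp : 0 < ‖z‖ ^ N := pow_pos (norm_pos_iff.2 hz0) N
    rw [norm_div, norm_pow, div_le_iff₀' hzp]
    exact hgB.norm_sub_le_pow_mul hO' hz
  have hl1 : Tendsto (fun z => (g z - g 0) / z ^ N) (𝓝[≠] 0) (𝓝 (coeff f N)) := by
    have hp : (fun z : ℂ => ‖z‖ ^ N) =O[𝓝 0] fun z => z ^ N := IsBigO.of_bound 1 (by simp)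
    have h1 : (fun z : ℂ => g z - (f 0 + coeff f N * z ^ N)) =o[𝓝[≠] 0] fun z => z ^ N :=
      ((hO.trans_isLittleO (isLittleO_norm_pow_norm_pow (E' := ℂ)
        (Nat.lt_succ_self N))).trans_isBigO hp).mono nhdsWithin_le_nhds
    have h2 := h1.tendsto_div_nhds_zero.add_const (coeff f N)
    rw [zero_add] at h2
    refine h2.congr' ?_
    filter_upwards [self_mem_nhdsWithin] with z hz0
    have : z ^ N ≠ 0 := pow_ne_zero _ hz0
    rw [hg0]
    field_simp
    ring
  have hl2 : Tendsto (fun z => ‖1 - conj (g 0) * g z‖) (𝓝[≠] 0)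
      (𝓝 ‖1 - conj (g 0) * g 0‖) := by
    have : Tendsto g (𝓝[≠] 0) (𝓝 (g 0)) :=
      (analyticAt_zero hgB.1).continuousAt.tendsto.mono_left nhdsWithin_le_nhds
    exact ((this.const_mul _).const_sub _).norm
  have h := le_of_tendsto_of_tendsto hl1.norm hl2 hb
  have hf1 := hf.2 0 zero_mem_unitDisk
  rw [hg0, Complex.conj_mul', ← Complex.ofReal_pow, ← Complex.ofReal_one, ← Complex.ofReal_sub,
    Complex.norm_real, Real.norm_eq_abs, abs_of_nonneg (by nlinarith [norm_nonneg (f 0)])] at h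
  exact h

/-- The Schwarz–Pick inequality for the derivative. -/
lemma ClassB.norm_deriv_le {f : ℂ → ℂ} (hf : ClassB f) {w : ℂ} (hw : w ∈ unitDisk) :
    ‖deriv f w‖ ≤ (1 - ‖f w‖ ^ 2) / (1 - ‖w‖ ^ 2) := by
  have hw1 := mem_unitDisk.1 hw
  have hw2 : 0 < 1 - ‖w‖ ^ 2 := by nlinarith [norm_nonneg w]
  have hden : ∀ z ∈ unitDisk, 1 + conj w * z ≠ 0 := by
    intro z hz h0
    have h1 : conj w * z = -1 := by linear_combination h0
    have h2 : ‖w‖ * ‖z‖ = 1 := by simpa using congrArg norm h1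
    nlinarith [mem_unitDisk.1 hz, norm_nonneg w, norm_nonneg z]
  have hmaps : ∀ z ∈ unitDisk, (z + w) / (1 + conj w * z) ∈ unitDisk := by
    intro z hz
    rw [mem_unitDisk, norm_div, div_lt_one (norm_pos_iff.2 (hden z hz))]
    have h := normSq_one_sub_conj_mul z (-w)
    simp only [map_neg, neg_mul, sub_neg_eq_add, norm_neg] at h
    have hz2 : 0 < 1 - ‖z‖ ^ 2 := by nlinarith [norm_nonneg z, mem_unitDisk.1 hz]
    have := mul_pos hz2 hw2
    exact lt_of_pow_lt_pow_left₀ 2 (norm_nonneg _) (by linarith)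
  -- A disk automorphism carries `0` to `w`, so the bound on the first coefficient applies; its
  -- derivative at `0` is `1 - |w|²`.
  have hB : ClassB fun z => f ((z + w) / (1 + conj w * z)) := by
    refine ⟨?_, fun z hz => hf.2 _ (hmaps z hz)⟩
    refine hf.1.comp (DifferentiableOn.div (by fun_prop) (by fun_prop) hden) hmaps
  have h := hB.norm_coeff_le le_rfl
  rw [coeff_one] at h
  have hd1 : HasDerivAt (fun z : ℂ => (z + w) / (1 + conj w * z)) (1 - conj w * w) 0 := by
    have := ((hasDerivAt_id (0 : ℂ)).add_const w).div
      (((hasDerivAt_id (0 : ℂ)).const_mul (conj w)).const_add 1) (by simp)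
    convert! this using 1
    simp
    ring
  have hd2 : HasDerivAt f (deriv f w) ((0 + w) / (1 + conj w * 0)) := by
    simpa using (hf.1.differentiableAt (isOpen_unitDisk.mem_nhds hw)).hasDerivAt
  have hd := (hd2.comp 0 hd1).deriv
  rw [Function.comp_def] at hd
  rw [hd, norm_mul, Complex.conj_mul', ← Complex.ofReal_pow, ← Complex.ofReal_one,
    ← Complex.ofReal_sub, Complex.norm_real, Real.norm_eq_abs, abs_of_pos hw2] at h
  rw [le_div_iff₀ hw2]
  simpa using h

/-- The growth estimate for functions bounded by one. -/
lemma ClassB.norm_le {f : ℂ → ℂ} (hf : ClassB f) {w : ℂ} (hw : w ∈ unitDisk) :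
    ‖f w‖ ≤ (‖f 0‖ + ‖w‖) / (1 + ‖f 0‖ * ‖w‖) := by
  have h := hf.norm_sub_le_pow_mul (n := 0) (by
    simpa using ((analyticAt_zero hf.1).continuousAt.tendsto.sub_const (f 0))) hw
  rw [zero_add, pow_one] at h
  have hid := normSq_one_sub_conj_mul (f w) (f 0)
  have hF := hf.2 w hw
  have hA := hf.2 0 zero_mem_unitDisk
  have hr := mem_unitDisk.1 hw
  have hr0 := norm_nonneg w
  have hF0 := norm_nonneg (f w)
  have hA0 := norm_nonneg (f 0)
  set F := ‖f w‖
  set A := ‖f 0‖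
  set r := ‖w‖
  set Q := ‖1 - conj (f 0) * f w‖
  have hQ : 1 - A * F ≤ Q := by
    have := norm_sub_norm_le (1 : ℂ) (conj (f 0) * f w)
    simpa using this
  have hAF : A * F ≤ 1 := by nlinarith
  have h2 : ‖f w - f 0‖ ^ 2 ≤ (r * Q) ^ 2 := pow_le_pow_left₀ (norm_nonneg _) h 2
  have h3 : (1 - r ^ 2) * (1 - A * F) ^ 2 ≤ (1 - F ^ 2) * (1 - A ^ 2) := by
    have : (1 - A * F) ^ 2 ≤ Q ^ 2 := pow_le_pow_left₀ (by linarith) hQ 2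
    nlinarith [mul_le_mul_of_nonneg_left this (show 0 ≤ 1 - r ^ 2 by nlinarith)]
  -- Follows from `h3` and `(1 - A F)² - (F - A)² = (1 - F²) (1 - A²)`.
  have h4 : F - A ≤ r * (1 - A * F) := by
    refine le_of_sq_le_sq ?_ (mul_nonneg hr0 (by linarith))
    nlinarith
  rw [le_div_iff₀ (by positivity)]
  linarith

/-! ### The Cesàro transform as an integral -/

lemma summable_norm_coeff_mul_pow {g : ℂ → ℂ} (hg : DifferentiableOn ℂ g unitDisk) {w : ℂ}
    (hw : w ∈ unitDisk) : Summable fun n => ‖coeff g n * w ^ n‖ := by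
  have h := (Complex.hasSum_taylorSeries_on_ball hg hw).summable.norm
  refine h.congr fun n => ?_
  simp [coeff, div_eq_inv_mul, mul_comm, mul_left_comm]

lemma hasSum_coeff {g : ℂ → ℂ} (hg : DifferentiableOn ℂ g unitDisk) {w : ℂ}
    (hw : w ∈ unitDisk) : HasSum (fun n => coeff g n * w ^ n) (g w) := by
  refine (Complex.hasSum_taylorSeries_on_ball hg hw).congr_fun fun n => ?_
  simp [coeff, div_eq_inv_mul, mul_comm, mul_left_comm]

lemma sum_coeff_mul_pow (g : ℂ → ℂ) (w : ℂ) (n : ℕ) :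
    ∑ k ∈ Finset.range (n + 1), coeff g k * w ^ k * w ^ (n - k) =
      (∑ k ∈ Finset.range (n + 1), coeff g k) * w ^ n := by
  rw [Finset.sum_mul]
  refine Finset.sum_congr rfl fun k hk => ?_
  rw [mul_assoc, ← pow_add, Nat.add_sub_cancel' (by simp at hk; omega)]

/-- Cauchy product of the Taylor series with the geometric series. -/
lemma hasSum_partialSum_coeff {g : ℂ → ℂ} (hg : DifferentiableOn ℂ g unitDisk) {w : ℂ}
    (hw : w ∈ unitDisk) :
    HasSum (fun n => (∑ k ∈ Finset.range (n + 1), coeff g k) * w ^ n) (g w / (1 - w)) := by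
  have h := hasSum_sum_range_mul_of_summable_norm (summable_norm_coeff_mul_pow hg hw)
    (summable_norm_geometric_of_norm_lt_one (mem_unitDisk.1 hw))
  rw [(hasSum_coeff hg hw).tsum_eq, tsum_geometric_of_norm_lt_one (mem_unitDisk.1 hw)] at h
  simpa only [sum_coeff_mul_pow, div_eq_mul_inv] using h

lemma summable_norm_partialSum_coeff {g : ℂ → ℂ} (hg : DifferentiableOn ℂ g unitDisk) {w : ℂ}
    (hw : w ∈ unitDisk) :
    Summable fun n => ‖(∑ k ∈ Finset.range (n + 1), coeff g k) * w ^ n‖ := by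
  have h := summable_norm_sum_mul_range_of_summable_norm (summable_norm_coeff_mul_pow hg hw)
    (summable_norm_geometric_of_norm_lt_one (mem_unitDisk.1 hw))
  simpa only [sum_coeff_mul_pow] using h

lemma norm_ofReal_mul_le {t : ℝ} (ht : t ∈ Icc (0 : ℝ) 1) (w : ℂ) : ‖(t : ℂ) * w‖ = t * ‖w‖ := by
  rw [norm_mul, Complex.norm_real, Real.norm_eq_abs, abs_of_nonneg ht.1]

lemma ofReal_mul_mem_unitDisk {t : ℝ} (ht : t ∈ Icc (0 : ℝ) 1) {w : ℂ} (hw : w ∈ unitDisk) :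
    (t : ℂ) * w ∈ unitDisk := by
  rw [mem_unitDisk, norm_ofReal_mul_le ht]
  nlinarith [mem_unitDisk.1 hw, norm_nonneg w, ht.1, ht.2]

/-- Integral representation of the Cesàro transform. -/
lemma hasSum_cesaroTerm {g : ℂ → ℂ} (hg : DifferentiableOn ℂ g unitDisk) {w : ℂ}
    (hw : w ∈ unitDisk) :
    HasSum (cesaroTerm g w) (∫ t in (0 : ℝ)..1, g (t * w) / (1 - t * w)) := by
  set c : ℕ → ℂ := fun n => ∑ k ∈ Finset.range (n + 1), coeff g k with hc
  have h : HasSum (fun n : ℕ => ∫ t in (0 : ℝ)..1, c n * ((t : ℂ) * w) ^ n)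
      (∫ t in (0 : ℝ)..1, g (t * w) / (1 - t * w)) := by
    -- The terms are largest at `t = 1`, where the series converges absolutely; the factor `1 / (n +
    -- 1)` comes from `∫₀¹ t ^ n dt`.
    refine intervalIntegral.hasSum_integral_of_dominated_convergence
      (fun n _ => ‖c n * w ^ n‖) (fun n => ?_) (fun n => ?_) ?_ ?_ ?_
    · exact (by fun_prop : Continuous fun t : ℝ => c n * ((t : ℂ) * w) ^ n).aestronglyMeasurable
    · refine Eventually.of_forall fun t ht => ?_
      rw [uIoc_of_le zero_le_one] at ht
      rw [norm_mul, norm_mul, norm_pow, norm_pow, norm_ofReal_mul_le ⟨ht.1.le, ht.2⟩]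
      refine mul_le_mul_of_nonneg_left (pow_le_pow_left₀ (by have := ht.1; positivity) ?_ n)
        (norm_nonneg _)
      exact mul_le_of_le_one_left (norm_nonneg _) ht.2
    · exact Eventually.of_forall fun t _ => summable_norm_partialSum_coeff hg hw
    · exact intervalIntegrable_const
    · refine Eventually.of_forall fun t ht => ?_
      rw [uIoc_of_le zero_le_one] at ht
      exact hasSum_partialSum_coeff hg (ofReal_mul_mem_unitDisk ⟨ht.1.le, ht.2⟩ hw)
  refine h.congr_fun fun n => ?_
  have h1 : ∀ t : ℝ, c n * ((t : ℂ) * w) ^ n = ((t ^ n : ℝ) : ℂ) * (c n * w ^ n) := fun t => by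
    push_cast; ring
  simp only [h1]
  rw [intervalIntegral.integral_mul_const, intervalIntegral.integral_ofReal, integral_pow]
  simp [cesaroTerm, hc]
  ring

lemma cesaro_eq_integral {g : ℂ → ℂ} (hg : DifferentiableOn ℂ g unitDisk) {w : ℂ}
    (hw : w ∈ unitDisk) : cesaro g w = ∫ t in (0 : ℝ)..1, g (t * w) / (1 - t * w) :=
  (hasSum_cesaroTerm hg hw).tsum_eq

lemma one_sub_ofReal_mul_ne_zero {t : ℝ} (ht : t ∈ Icc (0 : ℝ) 1) {w : ℂ} (hw : w ∈ unitDisk) :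
    1 - (t : ℂ) * w ≠ 0 := by
  intro h
  have h1 := mem_unitDisk.1 (ofReal_mul_mem_unitDisk ht hw)
  rw [← sub_eq_zero.1 h, norm_one] at h1
  exact lt_irrefl _ h1

lemma continuousOn_cesaro_integrand {g : ℂ → ℂ} (hg : DifferentiableOn ℂ g unitDisk) {w : ℂ}
    (hw : w ∈ unitDisk) :
    ContinuousOn (fun t : ℝ => g (t * w) / (1 - t * w)) (Icc 0 1) := by
  refine ContinuousOn.div ?_ (by fun_prop) fun t ht => one_sub_ofReal_mul_ne_zero ht hw
  exact hg.continuousOn.comp (by fun_prop) fun t ht => ofReal_mul_mem_unitDisk ht hw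

/-! ### The functions `φ_k` and their sum -/

lemma summable_phi (k : ℕ) {r : ℝ} (hr : r ∈ Ico (0 : ℝ) 1) :
    Summable fun j : ℕ => r ^ (k + j) / (((k + j : ℕ) : ℝ) + 1) := by
  refine Summable.of_nonneg_of_le (fun j => by have := hr.1; positivity) (fun j => ?_)
    ((summable_geometric_of_lt_one hr.1 hr.2).mul_left (r ^ k))
  rw [← pow_add]
  exact div_le_self (pow_nonneg hr.1 _) (by linarith [Nat.cast_nonneg (α := ℝ) (k + j)])

lemma phi_nonneg (k : ℕ) {r : ℝ} (hr : 0 ≤ r) : 0 ≤ phi k r :=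
  tsum_nonneg fun j => by positivity

lemma phi_eq_add_phi_succ (k : ℕ) {r : ℝ} (hr : r ∈ Ico (0 : ℝ) 1) :
    phi k r = r ^ k / (k + 1) + phi (k + 1) r := by
  rw [phi, (summable_phi k hr).tsum_eq_zero_add, phi]
  congr 1
  refine tsum_congr fun j => ?_
  rw [show k + (j + 1) = k + 1 + j by ring]

lemma phi_le (k : ℕ) {r : ℝ} (hr : r ∈ Ico (0 : ℝ) 1) :
    phi k r ≤ r ^ k / (k + 1) / (1 - r) := by
  have h := (hasSum_geometric_of_lt_one hr.1 hr.2).mul_left (r ^ k / (k + 1))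
  rw [← div_eq_mul_inv] at h
  refine hasSum_le (fun j => ?_) (summable_phi k hr).hasSum h
  rw [pow_add, div_mul_eq_mul_div]
  refine div_le_div_of_nonneg_left (by have := hr.1; positivity) (by positivity) ?_
  push_cast
  linarith [Nat.cast_nonneg (α := ℝ) j]

lemma phi_mono (k : ℕ) {r s : ℝ} (hr : 0 ≤ r) (hrs : r ≤ s) (hs : s < 1) : phi k r ≤ phi k s :=
  (summable_phi k ⟨hr, hrs.trans_lt hs⟩).tsum_le_tsum
    (fun j => by gcongr) (summable_phi k ⟨hr.trans hrs, hs⟩)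

lemma mul_phi_zero {r : ℝ} (hr : r ∈ Ico (0 : ℝ) 1) : r * phi 0 r = -Real.log (1 - r) := by
  rw [← (Real.hasSum_pow_div_log_of_abs_lt_one (by rw [abs_of_nonneg hr.1]; exact hr.2)).tsum_eq,
    phi, ← tsum_mul_left]
  refine tsum_congr fun j => ?_
  rw [zero_add]
  ring

lemma mul_phi_one {r : ℝ} (hr : r ∈ Ico (0 : ℝ) 1) : r * phi 1 r = -r - Real.log (1 - r) := by
  have h := phi_eq_add_phi_succ 0 hr
  norm_num at h
  linear_combination mul_phi_zero hr - r * h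

lemma phi_one_pos {r : ℝ} (hr : r ∈ Ioo (0 : ℝ) 1) : 0 < phi 1 r := by
  rw [phi_eq_add_phi_succ 1 ⟨hr.1.le, hr.2⟩]
  exact add_pos_of_pos_of_nonneg (by have := hr.1; positivity) (phi_nonneg _ hr.1.le)

lemma phi_one_div_mono {x y : ℝ} (hx : 0 < x) (hxy : x ≤ y) (hy : y < 1) :
    phi 1 x / x ≤ phi 1 y / y := by
  have hy0 : 0 < y := hx.trans_le hxy
  have hx' := summable_phi 1 ⟨hx.le, hxy.trans_lt hy⟩
  have hy' := summable_phi 1 ⟨hy0.le, hy⟩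
  rw [phi, phi, ← tsum_div_const, ← tsum_div_const]
  refine (hx'.div_const x).tsum_le_tsum (fun j => ?_) (hy'.div_const y)
  have : ∀ z : ℝ, 0 < z → z ^ (1 + j) / (((1 + j : ℕ) : ℝ) + 1) / z
      = z ^ j / (((1 + j : ℕ) : ℝ) + 1) := fun z hz => by
    rw [pow_add, pow_one]; field_simp
  rw [this x hx, this y hy0]
  gcongr

/-- Summation by parts: the increment `r ^ (k + 2) / (k + 3)` is counted `k + 1` times, and `(k + 1)
/ (k + 3) = 1 - 2 / (k + 3)`. The boundary term `K φ_{K+2}` tends to `0`. -/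
lemma sum_range_phi (K : ℕ) {r : ℝ} (hr : r ∈ Ico (0 : ℝ) 1) :
    ∑ k ∈ Finset.range K, phi (k + 2) r = K * phi (K + 2) r +
      ∑ k ∈ Finset.range K, (r ^ 2 * r ^ k - 2 * (r ^ (2 + k) / (((2 + k : ℕ) : ℝ) + 1))) := by
  induction K with
  | zero => simp
  | succ K ih =>
    rw [Finset.sum_range_succ, Finset.sum_range_succ, ih]
    have h := phi_eq_add_phi_succ (K + 2) hr
    rw [show K + 1 + 2 = K + 2 + 1 by ring]
    have h3 : (K : ℝ) + 3 ≠ 0 := by positivity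
    have h4 : (((K + 2 : ℕ) : ℝ) + 1) = K + 3 := by push_cast; ring
    have h5 : (((2 + K : ℕ) : ℝ) + 1) = K + 3 := by push_cast; ring
    rw [h4] at h
    rw [h5, show phi (K + 2 + 1) r = phi (K + 2) r - r ^ (K + 2) / (K + 3) by linarith]
    push_cast
    field_simp
    ring

lemma hasSum_phi {r : ℝ} (hr : r ∈ Ico (0 : ℝ) 1) :
    HasSum (fun k => phi (k + 2) r) (r ^ 2 / (1 - r) - 2 * phi 2 r) := by
  rw [hasSum_iff_tendsto_nat_of_nonneg fun _ => phi_nonneg _ hr.1]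
  have h1 : Tendsto (fun K : ℕ => (K : ℝ) * phi (K + 2) r) atTop (𝓝 0) := by
    refine squeeze_zero (fun K => mul_nonneg K.cast_nonneg (phi_nonneg _ hr.1)) (fun K => ?_)
      (by simpa using (tendsto_self_mul_const_pow_of_lt_one hr.1 hr.2).mul_const (r ^ 2 / (1 - r)))
    have h1r : 0 < 1 - r := sub_pos.2 hr.2
    rw [mul_assoc]
    refine mul_le_mul_of_nonneg_left ((phi_le _ hr).trans ?_) K.cast_nonneg
    rw [← mul_div_assoc, ← pow_add]
    refine div_le_div_of_nonneg_right (div_le_self (pow_nonneg hr.1 _) ?_) h1r.le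
    linarith [Nat.cast_nonneg (α := ℝ) (K + 2)]
  have h2 := (((hasSum_geometric_of_lt_one hr.1 hr.2).mul_left (r ^ 2)).sub
    ((summable_phi 2 hr).hasSum.mul_left 2)).tendsto_sum_nat
  have h3 := h1.add h2
  simp only [← sum_range_phi _ hr] at h3
  rw [zero_add, ← div_eq_mul_inv] at h3
  exact h3

lemma tsum_phi_eq {r : ℝ} (hr : r ∈ Ioo (0 : ℝ) 1) :
    ∑' k, phi (k + 2) r = r ^ 2 / (1 - r) + r + 2 + 2 / r * Real.log (1 - r) := by
  have hr' : r ∈ Ico (0 : ℝ) 1 := ⟨hr.1.le, hr.2⟩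
  rw [(hasSum_phi hr').tsum_eq]
  have h1 := phi_eq_add_phi_succ 1 hr'
  have h2 := mul_phi_one hr'
  have h3 : Real.log (1 - r) = -r - r * (r ^ 1 / ((1 : ℕ) + 1) + phi 2 r) := by
    rw [← h1, h2]; ring
  have := hr.1.ne'
  rw [h3]
  push_cast
  field_simp
  ring

lemma tsum_phi_mono {r s : ℝ} (hr : 0 ≤ r) (hrs : r ≤ s) (hs : s < 1) :
    ∑' k, phi (k + 2) r ≤ ∑' k, phi (k + 2) s :=
  (hasSum_phi ⟨hr, hrs.trans_lt hs⟩).summable.tsum_le_tsum (fun _ => phi_mono _ hr hrs hs)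
    (hasSum_phi ⟨hr.trans hrs, hs⟩).summable

/-! ### The two integral means occurring in `Φ_m` -/

/-- `∫₀¹ (1 + t x)⁻¹ dt`. -/
noncomputable def logMean (x : ℝ) : ℝ := ∫ t in (0 : ℝ)..1, 1 / (1 + t * x)

/-- `∫₀¹ 2 (1 + t x)⁻² (1 - t x)⁻¹ dt`. -/
noncomputable def kernelMean (x : ℝ) : ℝ := ∫ t in (0 : ℝ)..1, 2 / ((1 + t * x) ^ 2 * (1 - t * x))

lemma one_add_mul_pos {t x : ℝ} (ht : t ∈ Icc (0 : ℝ) 1) (hx : 0 ≤ x) : 0 < 1 + t * x := by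
  have := mul_nonneg ht.1 hx
  linarith

lemma one_sub_mul_pos {t x : ℝ} (ht : t ∈ Icc (0 : ℝ) 1) (hx : x ∈ Ico (0 : ℝ) 1) :
    0 < 1 - t * x := by
  nlinarith [ht.1, ht.2, hx.1, hx.2]

lemma intervalIntegrable_of_Icc {f : ℝ → ℝ} (hf : ContinuousOn f (Icc 0 1)) :
    IntervalIntegrable f MeasureTheory.volume 0 1 :=
  ContinuousOn.intervalIntegrable_of_Icc zero_le_one hf

lemma continuousOn_logMean_integrand {x : ℝ} (hx : x ∈ Ico (0 : ℝ) 1) :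
    ContinuousOn (fun t : ℝ => 1 / (1 + t * x)) (Icc 0 1) :=
  ContinuousOn.div (by fun_prop) (by fun_prop) fun _ ht => (one_add_mul_pos ht hx.1).ne'

lemma continuousOn_geometric_integrand {x : ℝ} (hx : x ∈ Ico (0 : ℝ) 1) :
    ContinuousOn (fun t : ℝ => 1 / (1 - t * x)) (Icc 0 1) :=
  ContinuousOn.div (by fun_prop) (by fun_prop) fun _ ht => (one_sub_mul_pos ht hx).ne'

lemma continuousOn_kernelMean_integrand {x : ℝ} (hx : x ∈ Ico (0 : ℝ) 1) :
    ContinuousOn (fun t : ℝ => 2 / ((1 + t * x) ^ 2 * (1 - t * x))) (Icc 0 1) :=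
  ContinuousOn.div (by fun_prop) (by fun_prop) fun _ ht =>
    (mul_pos (pow_pos (one_add_mul_pos ht hx.1) 2) (one_sub_mul_pos ht hx)).ne'

lemma hasDerivAt_log_one_add_mul {t x : ℝ} (h : 1 + t * x ≠ 0) :
    HasDerivAt (fun t : ℝ => Real.log (1 + t * x)) (x / (1 + t * x)) t := by
  have h1 : HasDerivAt (fun t : ℝ => 1 + t * x) x t := by
    simpa using ((hasDerivAt_id t).mul_const x).const_add 1
  exact h1.log h

lemma hasDerivAt_log_one_sub_mul {t x : ℝ} (h : 1 - t * x ≠ 0) :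
    HasDerivAt (fun t : ℝ => Real.log (1 - t * x)) (-x / (1 - t * x)) t := by
  have h1 : HasDerivAt (fun t : ℝ => 1 - t * x) (-x) t := by
    simpa using ((hasDerivAt_id t).mul_const x).const_sub 1
  exact h1.log h

lemma logMean_eq {x : ℝ} (hx : x ∈ Ioo (0 : ℝ) 1) : logMean x = Real.log (1 + x) / x := by
  have hx' : x ∈ Ico (0 : ℝ) 1 := ⟨hx.1.le, hx.2⟩
  have hx0 := hx.1.ne'
  rw [logMean, intervalIntegral.integral_eq_sub_of_hasDerivAt
    (f := fun t => Real.log (1 + t * x) / x)]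
  · simp
  · intro t ht
    rw [uIcc_of_le zero_le_one] at ht
    have h := one_add_mul_pos ht hx.1.le
    convert! (hasDerivAt_log_one_add_mul h.ne').div_const x using 1
    field_simp
  · exact intervalIntegrable_of_Icc (continuousOn_logMean_integrand hx')

lemma integral_one_div_one_sub_mul {x : ℝ} (hx : x ∈ Ioo (0 : ℝ) 1) :
    ∫ t in (0 : ℝ)..1, 1 / (1 - t * x) = -Real.log (1 - x) / x := by
  have hx' : x ∈ Ico (0 : ℝ) 1 := ⟨hx.1.le, hx.2⟩
  have hx0 := hx.1.ne'
  rw [intervalIntegral.integral_eq_sub_of_hasDerivAt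
    (f := fun t => -Real.log (1 - t * x) / x)]
  · simp
  · intro t ht
    rw [uIcc_of_le zero_le_one] at ht
    have h := one_sub_mul_pos ht hx'
    convert! (hasDerivAt_log_one_sub_mul h.ne').neg.div_const x using 1
    field_simp
  · exact intervalIntegrable_of_Icc (continuousOn_geometric_integrand hx')

lemma kernelMean_eq {x : ℝ} (hx : x ∈ Ioo (0 : ℝ) 1) : kernelMean x =
    (-Real.log (1 - x) + Real.log (1 + x) + (2 - 2 / (1 + x))) / (2 * x) := by
  have hx' : x ∈ Ico (0 : ℝ) 1 := ⟨hx.1.le, hx.2⟩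
  have hx0 := hx.1.ne'
  -- Partial fractions: `4 / ((1 + s)² (1 - s)) = 1 / (1 - s) + 1 / (1 + s) + 2 / (1 + s)²`. The
  -- constant `2` makes the primitive vanish at `t = 0`.
  rw [kernelMean, intervalIntegral.integral_eq_sub_of_hasDerivAt
    (f := fun t => (-Real.log (1 - t * x) + Real.log (1 + t * x) +
      (2 - 2 / (1 + t * x))) / (2 * x))]
  · simp
  · intro t ht
    rw [uIcc_of_le zero_le_one] at ht
    have h := one_sub_mul_pos ht hx'
    have h' := one_add_mul_pos ht hx.1.le
    have h1 : HasDerivAt (fun t : ℝ => 1 + t * x) x t := by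
      simpa using ((hasDerivAt_id t).mul_const x).const_add 1
    have h2 := ((hasDerivAt_const t (2 : ℝ)).div h1 h'.ne').const_sub 2
    convert! (((hasDerivAt_log_one_sub_mul h.ne').neg.add
      (hasDerivAt_log_one_add_mul h'.ne')).add h2).div_const (2 * x) using 1
    have h3 := h.ne'
    have h4 := h'.ne'
    field_simp
    ring
  · exact intervalIntegrable_of_Icc (continuousOn_kernelMean_integrand hx')

lemma logMean_antitone {x y : ℝ} (hx : 0 ≤ x) (hxy : x ≤ y) (hy : y < 1) :
    logMean y ≤ logMean x := by
  refine intervalIntegral.integral_mono_on zero_le_one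
    (intervalIntegrable_of_Icc (continuousOn_logMean_integrand ⟨hx.trans hxy, hy⟩))
    (intervalIntegrable_of_Icc (continuousOn_logMean_integrand ⟨hx, hxy.trans_lt hy⟩))
    fun t ht => one_div_le_one_div_of_le (one_add_mul_pos ht hx) ?_
  linarith [mul_le_mul_of_nonneg_left hxy ht.1]

/-- The integrand is convex in `t`, hence lies below its chord on `[0, 1]`. -/
lemma logMean_le {x : ℝ} (hx : x ∈ Ico (0 : ℝ) 1) : logMean x ≤ (2 + x) / (2 * (1 + x)) := by
  have h1 : 0 < 1 + x := by linarith [hx.1]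
  have h : logMean x ≤ ∫ t in (0 : ℝ)..1, (1 - t * (x / (1 + x))) := by
    refine intervalIntegral.integral_mono_on zero_le_one
      (intervalIntegrable_of_Icc (continuousOn_logMean_integrand hx))
      (Continuous.intervalIntegrable (by fun_prop) _ _) fun t ht => ?_
    rw [div_le_iff₀ (one_add_mul_pos ht hx.1)]
    have : (1 - t * (x / (1 + x))) * (1 + t * x) - 1 = t * (1 - t) * x ^ 2 / (1 + x) := by
      field_simp
      ring
    have h2 : 0 ≤ t * (1 - t) * x ^ 2 / (1 + x) := by
      have := ht.1
      have := sub_nonneg.2 ht.2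
      positivity
    linarith
  refine h.trans_eq ?_
  rw [intervalIntegral.integral_sub (by simp) (Continuous.intervalIntegrable (by fun_prop) _ _),
    intervalIntegral.integral_mul_const, integral_id]
  simp
  field_simp
  ring

lemma one_div_one_add_le_logMean {x : ℝ} (hx : x ∈ Ico (0 : ℝ) 1) : 1 / (1 + x) ≤ logMean x := by
  have h : ∫ _ in (0 : ℝ)..1, 1 / (1 + x) ≤ logMean x := by
    refine intervalIntegral.integral_mono_on zero_le_one (by simp)
      (intervalIntegrable_of_Icc (continuousOn_logMean_integrand hx)) fun t ht => ?_
    refine one_div_le_one_div_of_le (one_add_mul_pos ht hx.1) ?_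
    linarith [mul_le_of_le_one_left hx.1 ht.2]
  simpa using h

lemma kernelMean_nonneg {x : ℝ} (hx : x ∈ Ico (0 : ℝ) 1) : 0 ≤ kernelMean x :=
  intervalIntegral.integral_nonneg zero_le_one fun t ht => by
    have := one_sub_mul_pos ht hx
    have := one_add_mul_pos ht hx.1
    positivity

lemma kernelMean_le {x : ℝ} (hx : x ∈ Ico (0 : ℝ) 1) : kernelMean x ≤ 2 / (1 - x) := by
  have h : kernelMean x ≤ ∫ _ in (0 : ℝ)..1, 2 / (1 - x) := by
    refine intervalIntegral.integral_mono_on zero_le_one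
      (intervalIntegrable_of_Icc (continuousOn_kernelMean_integrand hx)) (by simp) fun t ht => ?_
    refine div_le_div_of_nonneg_left zero_le_two (sub_pos.2 hx.2) ?_
    have h1 : 1 - x ≤ 1 - t * x := by linarith [mul_le_of_le_one_left hx.1 ht.2]
    have h2 : 1 ≤ (1 + t * x) ^ 2 := one_le_pow₀ (by linarith [mul_nonneg ht.1 hx.1])
    nlinarith [one_sub_mul_pos ht hx]
  simpa using h

/-- The factor `x` is essential, as `kernelMean` itself decreases near `0`. It is compensated by
`phi 1 x / x`, which is still increasing. -/
lemma mul_kernelMean_strictMono {x y : ℝ} (hx : 0 < x) (hxy : x < y) (hy : y < 1) :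
    x * kernelMean x < y * kernelMean y := by
  have hy0 := hx.trans hxy
  rw [kernelMean_eq ⟨hx, hxy.trans hy⟩, kernelMean_eq ⟨hy0, hy⟩]
  have h1 : Real.log (1 - y) < Real.log (1 - x) := Real.log_lt_log (by linarith) (by linarith)
  have h2 : Real.log (1 + x) < Real.log (1 + y) := Real.log_lt_log (by linarith) (by linarith)
  have h3 : 2 / (1 + y) < 2 / (1 + x) :=
    div_lt_div_of_pos_left two_pos (by linarith) (by linarith)
  have h4 : ∀ z c : ℝ, 0 < z → z * (c / (2 * z)) = c / 2 := fun z c hz => by field_simp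
  rw [h4 x _ hx, h4 y _ hy0]
  linarith

/-! ### Monotonicity of `Φ_m` and the two radii -/

/-- In this form `Φ_m` arises as the coefficient of `1 - |f(0)|` in the main estimate. -/
lemma Phi_eq {m : ℕ} (hm : 1 ≤ m) {r : ℝ} (hr : r ∈ Ioo (0 : ℝ) 1) :
    Phi m r = phi 1 (r ^ m) * kernelMean (r ^ m) - logMean (r ^ m)
      + 2 * ∑' k, phi (k + 2) r := by
  have hx : r ^ m ∈ Ioo (0 : ℝ) 1 := ⟨pow_pos hr.1 m, pow_lt_one₀ hr.1.le hr.2 (by omega)⟩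
  have h1 := mul_phi_one (r := r ^ m) ⟨hx.1.le, hx.2⟩
  rw [Phi, tsum_phi_eq hr, kernelMean_eq hx, logMean_eq hx, ← h1]
  have h0 := hx.1.ne'
  have h2 : 1 + r ^ m ≠ 0 := by linarith [hx.1]
  field_simp
  ring

lemma Phi_strictMono {m : ℕ} (hm : 1 ≤ m) {r s : ℝ} (hr : 0 < r) (hrs : r < s) (hs : s < 1) :
    Phi m r < Phi m s := by
  have hs0 := hr.trans hrs
  rw [Phi_eq hm ⟨hr, hrs.trans hs⟩, Phi_eq hm ⟨hs0, hs⟩]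
  have hx : 0 < r ^ m := pow_pos hr m
  have hxy : r ^ m < s ^ m := pow_lt_pow_left₀ hrs hr.le (by omega)
  have hy : s ^ m < 1 := pow_lt_one₀ hs0.le hs (by omega)
  generalize r ^ m = x at *
  generalize s ^ m = y at *
  have h1 := tsum_phi_mono hr.le hrs.le hs
  have h2 := logMean_antitone hx.le hxy.le hy
  have h3 : phi 1 x * kernelMean x < phi 1 y * kernelMean y := by
    have h4 : ∀ z, 0 < z → phi 1 z * kernelMean z = phi 1 z / z * (z * kernelMean z) :=
      fun z hz => by field_simp
    rw [h4 x hx, h4 y (hx.trans hxy)]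
    have hpos : 0 < phi 1 y / y := div_pos (phi_one_pos ⟨hx.trans hxy, hy⟩) (hx.trans hxy)
    calc phi 1 x / x * (x * kernelMean x)
        ≤ phi 1 y / y * (x * kernelMean x) :=
          mul_le_mul_of_nonneg_right (phi_one_div_mono hx hxy.le hy)
            (mul_nonneg hx.le (kernelMean_nonneg ⟨hx.le, hxy.trans hy⟩))
      _ < phi 1 y / y * (y * kernelMean y) :=
          mul_lt_mul_of_pos_left (mul_kernelMean_strictMono hx hxy hy) hpos
  linarith

lemma RmEquation_iff {m : ℕ} (hm : 1 ≤ m) {r : ℝ} (hr : r ∈ Ioo (0 : ℝ) 1) :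
    RmEquation m r ↔ 2 * phi 1 (r ^ m) = 1 - (r ^ m) ^ 2 := by
  have hx : r ^ m ∈ Ioo (0 : ℝ) 1 := ⟨pow_pos hr.1 m, pow_lt_one₀ hr.1.le hr.2 (by omega)⟩
  rw [RmEquation, ← mul_phi_one ⟨hx.1.le, hx.2⟩, mul_comm 2 m, pow_mul, mul_left_comm,
    mul_right_inj' hx.1.ne']

/-- The first equation depends only on `x = r ^ m`, so one root `x` serves every `m`. The narrow
bracket feeds the polynomial inequality in `Phi_pos_of_two_mul_phi_one_eq`. -/
lemma exists_two_mul_phi_one_eq :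
    ∃ x ∈ Ioo (2 / 5 : ℝ) (1 / 2), 2 * phi 1 x = 1 - x ^ 2 := by
  set h : ℝ → ℝ := fun x => 2 * (-x - Real.log (1 - x)) - x * (1 - x ^ 2) with hh
  have hhx : ∀ x ∈ Ioo (0 : ℝ) 1, h x = x * (2 * phi 1 x - (1 - x ^ 2)) := fun x hx => by
    rw [hh]
    linear_combination -2 * mul_phi_one (r := x) ⟨hx.1.le, hx.2⟩
  have hc : ContinuousOn h (Icc (2 / 5) (1 / 2)) := by
    have hl : ContinuousOn (fun x : ℝ => Real.log (1 - x)) (Icc (2 / 5) (1 / 2)) :=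
      ContinuousOn.log (by fun_prop) fun x hx => by linarith [hx.2]
    fun_prop
  have h0 : h (2 / 5) < 0 := by
    rw [hhx _ (by norm_num)]
    have := phi_le 1 (r := 2 / 5) (by norm_num)
    norm_num at this ⊢
    linarith
  have h1 : 0 < h (1 / 2) := by
    have := Real.log_two_gt_d9
    rw [hh]
    norm_num
    rw [show (1 / 2 : ℝ) = 2⁻¹ by norm_num, Real.log_inv]
    linarith
  obtain ⟨x, hx, hx0⟩ := intermediate_value_Ioo (by norm_num) hc ⟨h0, h1⟩
  refine ⟨x, hx, ?_⟩
  have hx01 : x ∈ Ioo (0 : ℝ) 1 := ⟨by linarith [hx.1], by linarith [hx.2]⟩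
  rw [hhx x hx01] at hx0
  have := (mul_eq_zero.1 hx0).resolve_left hx01.1.ne'
  linarith

/-- Since `r ^ m ≤ r`, the tail can be evaluated at `x = r ^ m` and cut to `φ₂ + φ₃ ≥ x² / 3 + x³ /
2`. After substituting `φ₁ = (1 - x²) / 2`, `logMean` has a negative coefficient, so its chord bound
leaves a rational function of `x`. -/
lemma Phi_pos_of_two_mul_phi_one_eq {m : ℕ} (hm : 1 ≤ m) {r : ℝ} (hr : r ∈ Ioo (0 : ℝ) 1)
    (hx : r ^ m ∈ Ioo (2 / 5 : ℝ) (1 / 2)) (heq : 2 * phi 1 (r ^ m) = 1 - (r ^ m) ^ 2) :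
    0 < Phi m r := by
  have hxr : r ^ m ≤ r := pow_le_of_le_one hr.1.le hr.2.le (by omega)
  have hN := tsum_phi_mono (by linarith [hx.1]) hxr hr.2
  rw [Phi_eq hm hr]
  generalize r ^ m = x at *
  have hx0 : 0 < x := by linarith [hx.1]
  have hx1 : x < 1 := by linarith [hx.2]
  have hxI : x ∈ Ico (0 : ℝ) 1 := ⟨hx0.le, hx1⟩
  have hN2 : phi 2 x + phi 3 x ≤ ∑' k, phi (k + 2) x := by
    have := (hasSum_phi hxI).summable.sum_le_tsum (Finset.range 2)
      fun _ _ => phi_nonneg _ hx0.le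
    simpa [Finset.sum_range_succ] using this
  have hp2 : x ^ 2 / 3 + phi 3 x = phi 2 x := by
    have := phi_eq_add_phi_succ 2 hxI
    norm_num at this
    linarith
  have hp3 : x ^ 3 / 4 ≤ phi 3 x := by
    have := phi_eq_add_phi_succ 3 hxI
    norm_num at this
    linarith [phi_nonneg 4 hx0.le]
  have hK : x * kernelMean x = (x * phi 1 x + x + x * logMean x + (2 - 2 / (1 + x))) / 2 := by
    rw [kernelMean_eq ⟨hx0, hx1⟩, mul_phi_one hxI, logMean_eq ⟨hx0, hx1⟩]
    field_simp
    ring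
  have hK' : kernelMean x = (phi 1 x + 1 + logMean x + 2 / (1 + x)) / 2 := by
    have h1 : (1 + x) ≠ 0 := by linarith
    have h2 : 2 - 2 / (1 + x) = x * (2 / (1 + x)) := by field_simp; ring
    rw [h2] at hK
    apply mul_left_cancel₀ hx0.ne'
    rw [hK]; ring
  have hM := logMean_le hxI
  have hphi : phi 1 x = (1 - x ^ 2) / 2 := by linarith
  rw [hK', hphi]
  have h2 : 2 / (1 + x) = 1 + (1 - x) / (1 + x) := by field_simp; ring
  have hMc : (1 - (1 - x ^ 2) / 4) * logMean x ≤
      (1 - (1 - x ^ 2) / 4) * ((2 + x) / (2 * (1 + x))) :=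
    mul_le_mul_of_nonneg_left hM (by nlinarith)
  have hfin : 0 < (1 - x ^ 2) / 4 * ((1 - x ^ 2) / 2 + 1 + 2 / (1 + x)) -
      (1 - (1 - x ^ 2) / 4) * ((2 + x) / (2 * (1 + x))) + 2 * (x ^ 2 / 3 + x ^ 3 / 2) := by
    have : (1 - x ^ 2) / 4 * ((1 - x ^ 2) / 2 + 1 + 2 / (1 + x)) -
        (1 - (1 - x ^ 2) / 4) * ((2 + x) / (2 * (1 + x))) + 2 * (x ^ 2 / 3 + x ^ 3 / 2)
        = (3 - 14 * x ^ 2 + 25 * x ^ 3 + 27 * x ^ 4 + 3 * x ^ 5) / (24 * (1 + x)) := by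
      field_simp
      ring
    rw [this]
    -- Here `x > 2 / 5` is used; with `x² ≤ 1 / 4` the numerator exceeds `3 - 4 x² ≥ 2`.
    have h3 : x ^ 2 * (14 - 25 * x) ≤ x ^ 2 * 4 :=
      mul_le_mul_of_nonneg_left (by linarith [hx.1]) (sq_nonneg x)
    have h4 : x ^ 2 ≤ 1 / 4 := by nlinarith [hx.2]
    have h5 : 0 < x ^ 4 := by positivity
    have h6 : 0 < x ^ 5 := by positivity
    exact div_pos (by nlinarith) (by positivity)
  nlinarith

lemma continuousOn_Phi (m : ℕ) (hm : 1 ≤ m) {s t : ℝ} (hs : 0 < s) (ht : t < 1) :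
    ContinuousOn (Phi m) (Icc s t) := by
  have h0 : ∀ r ∈ Icc s t, r ≠ 0 := fun r hr => (hs.trans_le hr.1).ne'
  have h1 : ∀ r ∈ Icc s t, 0 < r ^ m := fun r hr => pow_pos (hs.trans_le hr.1) m
  have h2 : ∀ r ∈ Icc s t, r ^ m < 1 := fun r hr =>
    pow_lt_one₀ (hs.trans_le hr.1).le (hr.2.trans_lt ht) (by omega)
  have h3 : ContinuousOn (fun r : ℝ => Real.log (1 - r ^ m)) (Icc s t) :=
    ContinuousOn.log (by fun_prop) fun r hr => by linarith [h2 r hr]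
  have h4 : ContinuousOn (fun r : ℝ => Real.log (1 + r ^ m)) (Icc s t) :=
    ContinuousOn.log (by fun_prop) fun r hr => by linarith [h1 r hr]
  have h5 : ContinuousOn (fun r : ℝ => Real.log (1 - r)) (Icc s t) :=
    ContinuousOn.log (by fun_prop) fun r hr => by linarith [hr.2]
  have h6 : ContinuousOn (fun r : ℝ => 1 / r ^ m) (Icc s t) :=
    ContinuousOn.div (by fun_prop) (by fun_prop) fun r hr => (h1 r hr).ne'
  have h7 : ContinuousOn (fun r : ℝ => 2 / r) (Icc s t) :=
    ContinuousOn.div (by fun_prop) (by fun_prop) h0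
  have h8 : ContinuousOn (fun r : ℝ => 2 / (1 + r ^ m)) (Icc s t) :=
    ContinuousOn.div (by fun_prop) (by fun_prop) fun r hr => by linarith [h1 r hr]
  have h9 : ContinuousOn (fun r : ℝ => r ^ 2 / (1 - r)) (Icc s t) :=
    ContinuousOn.div (by fun_prop) (by fun_prop) fun r hr => by linarith [hr.2]
  have h10 : ContinuousOn (fun r : ℝ => (-r ^ m - Real.log (1 - r ^ m)) / (2 * r ^ m))
      (Icc s t) :=
    ContinuousOn.div (by fun_prop) (by fun_prop) fun r hr => by linarith [h1 r hr]
  unfold Phi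
  fun_prop

lemma Phi_neg {m : ℕ} (hm : 1 ≤ m) : Phi m (1 / 10) < 0 := by
  have hr : (1 / 10 : ℝ) ∈ Ioo (0 : ℝ) 1 := by norm_num
  rw [Phi_eq hm hr, (hasSum_phi ⟨hr.1.le, hr.2⟩).tsum_eq]
  have hx0 : (0 : ℝ) < (1 / 10) ^ m := by positivity
  have hx1 : (1 / 10 : ℝ) ^ m ≤ 1 / 10 := pow_le_of_le_one (by norm_num) (by norm_num) (by omega)
  have h1 := phi_nonneg 2 hr.1.le
  generalize (1 / 10 : ℝ) ^ m = x at *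
  have hx : x ∈ Ico (0 : ℝ) 1 := ⟨hx0.le, by linarith⟩
  have h2 : phi 1 x ≤ 1 / 18 := by
    refine (phi_mono 1 hx0.le hx1 hr.2).trans ((phi_le 1 ⟨hr.1.le, hr.2⟩).trans ?_)
    norm_num
  have h3 : kernelMean x ≤ 20 / 9 := by
    refine (kernelMean_le hx).trans ?_
    rw [div_le_iff₀ (by linarith)]
    linarith
  have h4 : 10 / 11 ≤ logMean x := by
    refine le_trans ?_ (one_div_one_add_le_logMean hx)
    rw [le_div_iff₀ (by linarith)]
    linarith
  have h5 := mul_le_mul h2 h3 (kernelMean_nonneg hx) (by norm_num)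
  norm_num at h5 h1 ⊢
  linarith

/-- The radii `R_m` and `R_{m,1}`. -/
lemma exists_radii {m : ℕ} (hm : 1 ≤ m) : ∃ Rm Rm1 : ℝ,
    (Rm ∈ Ioo (0 : ℝ) 1 ∧ RmEquation m Rm ∧
      ∀ s ∈ Ioo (0 : ℝ) 1, RmEquation m s → s = Rm) ∧
    (Rm1 ∈ Ioo (0 : ℝ) 1 ∧ Phi m Rm1 = 0 ∧
      ∀ s ∈ Ioo (0 : ℝ) 1, Phi m s = 0 → s = Rm1) ∧ Rm1 ≤ Rm := by
  have hm0 : m ≠ 0 := by omega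
  obtain ⟨x, hx, hxe⟩ := exists_two_mul_phi_one_eq
  have hx0 : 0 < x := by linarith [hx.1]
  have hx1 : x < 1 := by linarith [hx.2]
  set R : ℝ := x ^ ((m : ℝ)⁻¹) with hR
  have hRx : R ^ m = x := Real.rpow_inv_natCast_pow hx0.le hm0
  have hRI : R ∈ Ioo (0 : ℝ) 1 :=
    ⟨Real.rpow_pos_of_pos hx0 _, Real.rpow_lt_one hx0.le hx1 (by positivity)⟩
  have hPR : 0 < Phi m R :=
    Phi_pos_of_two_mul_phi_one_eq hm hRI (by rwa [hRx]) (by rwa [hRx])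
  have hxR : x ≤ R := hRx ▸ pow_le_of_le_one hRI.1.le hRI.2.le hm0
  obtain ⟨R1, hR1, hR10⟩ := intermediate_value_Ioo (by linarith [hx.1] : (1 / 10 : ℝ) ≤ R)
    (continuousOn_Phi m hm (by norm_num) hRI.2) ⟨Phi_neg hm, hPR⟩
  have hR1I : R1 ∈ Ioo (0 : ℝ) 1 := ⟨by linarith [hR1.1], hR1.2.trans hRI.2⟩
  refine ⟨R, R1, ⟨hRI, (RmEquation_iff hm hRI).2 (by rwa [hRx]), ?_⟩,
    ⟨hR1I, hR10, ?_⟩, hR1.2.le⟩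
  · intro s hs hse
    rw [RmEquation_iff hm hs] at hse
    have hs0 : 0 < s ^ m := pow_pos hs.1 m
    have hs1 : s ^ m < 1 := pow_lt_one₀ hs.1.le hs.2 hm0
    refine (pow_left_inj₀ hs.1.le hRI.1.le hm0).1 ?_
    rw [hRx]
    -- In the variable `r ^ m`, `φ₁` is nondecreasing while `1 - (r ^ m)²` strictly decreases.
    rcases lt_trichotomy (s ^ m) x with h | h | h
    · nlinarith [phi_mono 1 hs0.le h.le hx1]
    · exact h
    · nlinarith [phi_mono 1 hx0.le h.le hs1]
  · intro s hs hse
    rcases lt_trichotomy s R1 with h | h | h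
    · linarith [Phi_strictMono hm hs.1 h hR1I.2]
    · exact h
    · linarith [Phi_strictMono hm hR1I.1 h hs.2]

/-! ### The upper bound -/

lemma integrand_identity {A φ s : ℝ} (h1 : 1 + A * s ≠ 0) (h2 : 1 - s ≠ 0) :
    ((A + s) / (1 + A * s) + φ * ((1 - A ^ 2) / (1 + A * s) ^ 2)) / (1 - s) =
      1 / (1 - s) + (1 - A) * (-(1 / (1 + A * s)) +
        φ * ((1 + A) / ((1 + A * s) ^ 2 * (1 - s)))) := by
  field_simp
  ring

/-- The heart of the proof. With `κ = φ / (1 - s²) ≤ 1 / 2`, passing from `F` to the extremal `u`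
changes the numerator by `(u - F) (1 - κ (u + F)) ≥ 0`. `integrand_identity` then extracts `1 - A`,
and the remaining bracket is compared with its value at `A = 1`. -/
lemma integrand_le {A F φ σ s : ℝ} (hA : A ∈ Icc (0 : ℝ) 1) (hσ : 0 ≤ σ) (hσs : σ ≤ s)
    (hs : s < 1) (hφ : 0 ≤ φ) (hφs : 2 * φ ≤ 1 - s ^ 2) (hF : 0 ≤ F)
    (hFu : F ≤ (A + σ) / (1 + A * σ)) :
    (F + φ * ((1 - F ^ 2) / (1 - σ ^ 2))) / (1 - σ) ≤
      1 / (1 - s) + (1 - A) * (-(1 / (1 + s)) + φ * (2 / ((1 + s) ^ 2 * (1 - s)))) := by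
  have hs0 : 0 ≤ s := hσ.trans hσs
  have hA0 := hA.1
  have hA1 := sub_nonneg.2 hA.2
  have h1 : 0 < 1 + A * s := by positivity
  have h1' : 0 < 1 + A * σ := by positivity
  have h2 : 0 < 1 - s := by linarith
  have h2' : 0 < 1 - σ := by linarith
  have h3 : 0 < 1 + s := by linarith
  have h4 : 0 < 1 - s ^ 2 := by nlinarith
  have h4' : 1 - s ^ 2 ≤ 1 - σ ^ 2 := by nlinarith
  set u := (A + s) / (1 + A * s) with hu
  have hFu' : F ≤ u := by
    refine hFu.trans ?_
    rw [hu, div_le_div_iff₀ h1' h1]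
    nlinarith [mul_nonneg (sub_nonneg.2 hσs) (mul_nonneg hA1 (add_nonneg zero_le_one hA0))]
  have hu1 : u ≤ 1 := by
    rw [hu, div_le_one h1]
    nlinarith [mul_nonneg hA1 h2.le]
  have hF2 : 0 ≤ 1 - F ^ 2 := by nlinarith
  have hstep1 : F + φ * ((1 - F ^ 2) / (1 - σ ^ 2)) ≤ F + φ * ((1 - F ^ 2) / (1 - s ^ 2)) := by
    gcongr
  have hstep2 : F + φ * ((1 - F ^ 2) / (1 - s ^ 2)) ≤ u + φ * ((1 - u ^ 2) / (1 - s ^ 2)) := by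
    have hκ : φ / (1 - s ^ 2) ≤ 1 / 2 := by rw [div_le_iff₀ h4]; linarith
    have hκ0 : 0 ≤ φ / (1 - s ^ 2) := div_nonneg hφ h4.le
    have hid : u + φ * ((1 - u ^ 2) / (1 - s ^ 2)) - (F + φ * ((1 - F ^ 2) / (1 - s ^ 2)))
        = (u - F) * (1 - φ / (1 - s ^ 2) * (u + F)) := by ring
    have : 0 ≤ (u - F) * (1 - φ / (1 - s ^ 2) * (u + F)) :=
      mul_nonneg (sub_nonneg.2 hFu') (by nlinarith)
    linarith
  have hu2 : (1 - u ^ 2) / (1 - s ^ 2) = (1 - A ^ 2) / (1 + A * s) ^ 2 := by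
    rw [hu]
    field_simp
    ring
  have hnum : 0 ≤ u + φ * ((1 - u ^ 2) / (1 - s ^ 2)) := by
    have : 0 ≤ u := hF.trans hFu'
    have : 0 ≤ 1 - u ^ 2 := by nlinarith
    positivity
  calc (F + φ * ((1 - F ^ 2) / (1 - σ ^ 2))) / (1 - σ)
      ≤ (u + φ * ((1 - u ^ 2) / (1 - s ^ 2))) / (1 - s) :=
        div_le_div₀ hnum (hstep1.trans hstep2) h2 (by linarith)
    _ = 1 / (1 - s) + (1 - A) * (-(1 / (1 + A * s)) +
        φ * ((1 + A) / ((1 + A * s) ^ 2 * (1 - s)))) := by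
        rw [hu2, hu, integrand_identity h1.ne' h2.ne']
    _ ≤ _ := by
        refine add_le_add_right (mul_le_mul_of_nonneg_left ?_ hA1) _
        have hid : -(1 / (1 + s)) + φ * (2 / ((1 + s) ^ 2 * (1 - s))) -
            (-(1 / (1 + A * s)) + φ * ((1 + A) / ((1 + A * s) ^ 2 * (1 - s)))) =
            (1 - A) * (s * (1 + A * s) * (1 + s) * (1 - s) +
              φ * (1 - 2 * s - s ^ 2 - 2 * s ^ 2 * A)) /
              ((1 - s) * (1 + A * s) ^ 2 * (1 + s) ^ 2) := by
          field_simp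
          ring
        have hpos : 0 ≤ s * (1 + A * s) * (1 + s) * (1 - s) +
            φ * (1 - 2 * s - s ^ 2 - 2 * s ^ 2 * A) := by
          rcases le_total 0 (1 - 2 * s - s ^ 2 - 2 * s ^ 2 * A) with h | h
          · positivity
          -- The expression is affine in `φ`, now with nonpositive slope, and equals `(1 - s²)² / 2`
          -- at the extreme value `φ = (1 - s²) / 2`.
          · have h5 := mul_le_mul_of_nonpos_right hφs h
            nlinarith [sq_nonneg (1 - s ^ 2)]
        have : 0 ≤ (1 - A) * (s * (1 + A * s) * (1 + s) * (1 - s) +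
              φ * (1 - 2 * s - s ^ 2 - 2 * s ^ 2 * A)) /
              ((1 - s) * (1 + A * s) ^ 2 * (1 + s) ^ 2) := by positivity
        linarith

/-- The parameters cover both uses: `c = 0`, `e = 1` for the upper bound, and `c = 1 - a`, `e = (1 +
a) / 2` for the Möbius functions. -/
lemma integral_majorant {x : ℝ} (hx : x ∈ Ioo (0 : ℝ) 1) (b c d e : ℝ) :
    ∫ t in (0 : ℝ)..1, (1 / (1 - t * x) + b * (-(1 / (1 + t * x)) - c +
        d * (e * (2 / ((1 + t * x) ^ 2 * (1 - t * x)))))) =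
      -Real.log (1 - x) / x + b * (-logMean x - c + d * (e * kernelMean x)) := by
  have hx' : x ∈ Ico (0 : ℝ) 1 := ⟨hx.1.le, hx.2⟩
  have h1 := intervalIntegrable_of_Icc (continuousOn_geometric_integrand hx')
  have h2 := intervalIntegrable_of_Icc (continuousOn_logMean_integrand hx')
  have h3 := intervalIntegrable_of_Icc (continuousOn_kernelMean_integrand hx')
  have h3' := (h3.const_mul e).const_mul d
  have h2n : IntervalIntegrable (fun t => -(1 / (1 + t * x))) MeasureTheory.volume 0 1 := h2.neg
  have h2' := h2n.sub (intervalIntegrable_const (c := c))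
  rw [intervalIntegral.integral_add h1 ((h2'.add h3').const_mul b),
    intervalIntegral.integral_const_mul, intervalIntegral.integral_add h2' h3',
    intervalIntegral.integral_sub h2n (intervalIntegrable_const (c := c)),
    intervalIntegral.integral_neg, intervalIntegral.integral_const_mul,
    intervalIntegral.integral_const_mul, integral_one_div_one_sub_mul hx, logMean, kernelMean]
  simp

lemma intervalIntegrable_majorant {x : ℝ} (hx : x ∈ Ioo (0 : ℝ) 1) (b c d e : ℝ) :
    IntervalIntegrable (fun t => 1 / (1 - t * x) + b * (-(1 / (1 + t * x)) - c +
        d * (e * (2 / ((1 + t * x) ^ 2 * (1 - t * x)))))) MeasureTheory.volume 0 1 := by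
  have hx' : x ∈ Ico (0 : ℝ) 1 := ⟨hx.1.le, hx.2⟩
  have h1 := intervalIntegrable_of_Icc (continuousOn_geometric_integrand hx')
  have h2 := intervalIntegrable_of_Icc (continuousOn_logMean_integrand hx')
  have h3 := intervalIntegrable_of_Icc (continuousOn_kernelMean_integrand hx')
  exact h1.add
    (((h2.neg.sub intervalIntegrable_const).add ((h3.const_mul e).const_mul d)).const_mul b)

lemma differentiableOn_deriv {f : ℂ → ℂ} (hf : DifferentiableOn ℂ f unitDisk) :
    DifferentiableOn ℂ (deriv f) unitDisk := hf.deriv isOpen_unitDisk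

lemma ClassB.norm_cesaro_add_le {f : ℂ → ℂ} (hf : ClassB f) {w : ℂ} {x φ : ℝ}
    (hx : x ∈ Ioo (0 : ℝ) 1) (hw : ‖w‖ ≤ x) (hφ : 0 ≤ φ) (hφx : 2 * φ ≤ 1 - x ^ 2) :
    ‖cesaro f w‖ + ‖cesaro (deriv f) w‖ * φ ≤
      -Real.log (1 - x) / x + (1 - ‖f 0‖) * (-logMean x + φ * kernelMean x) := by
  have hwD : w ∈ unitDisk := mem_unitDisk.2 (hw.trans_lt hx.2)
  have hfd := differentiableOn_deriv hf.1
  have hi1 : IntervalIntegrable (fun t : ℝ => ‖f (t * w) / (1 - t * w)‖)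
      MeasureTheory.volume 0 1 :=
    intervalIntegrable_of_Icc (continuousOn_cesaro_integrand hf.1 hwD).norm
  have hi2 : IntervalIntegrable (fun t : ℝ => ‖deriv f (t * w) / (1 - t * w)‖)
      MeasureTheory.volume 0 1 :=
    intervalIntegrable_of_Icc (continuousOn_cesaro_integrand hfd hwD).norm
  rw [cesaro_eq_integral hf.1 hwD, cesaro_eq_integral hfd hwD]
  have hM := integral_majorant hx (1 - ‖f 0‖) 0 φ 1
  simp only [sub_zero, one_mul] at hM
  have hMi := intervalIntegrable_majorant hx (1 - ‖f 0‖) 0 φ 1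
  simp only [sub_zero, one_mul] at hMi
  rw [← hM]
  calc _ ≤ (∫ t in (0 : ℝ)..1, ‖f (t * w) / (1 - t * w)‖) +
        (∫ t in (0 : ℝ)..1, ‖deriv f (t * w) / (1 - t * w)‖) * φ :=
      add_le_add (intervalIntegral.norm_integral_le_integral_norm zero_le_one)
        (mul_le_mul_of_nonneg_right
          (intervalIntegral.norm_integral_le_integral_norm zero_le_one) hφ)
    _ = ∫ t in (0 : ℝ)..1, (‖f (t * w) / (1 - t * w)‖ +
        ‖deriv f (t * w) / (1 - t * w)‖ * φ) := by
      rw [intervalIntegral.integral_add hi1 (hi2.mul_const φ),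
        intervalIntegral.integral_mul_const]
    _ ≤ _ := by
      refine intervalIntegral.integral_mono_on zero_le_one (hi1.add (hi2.mul_const φ)) hMi
        fun t ht => ?_
      have htw := ofReal_mul_mem_unitDisk ht hwD
      have hn := norm_ofReal_mul_le ht w
      have hσs : t * ‖w‖ ≤ t * x := mul_le_mul_of_nonneg_left hw ht.1
      have htx : t * x ≤ x := mul_le_of_le_one_left hx.1.le ht.2
      have hσ : 0 ≤ t * ‖w‖ := mul_nonneg ht.1 (norm_nonneg w)
      have hσ1 : t * ‖w‖ < 1 := by linarith [hx.2]
      have h := integrand_le (A := ‖f 0‖) (F := ‖f (t * w)‖) (φ := φ) (σ := t * ‖w‖)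
        (s := t * x) ⟨norm_nonneg _, hf.2 0 zero_mem_unitDisk⟩ hσ hσs
        (htx.trans_lt hx.2) hφ (by nlinarith) (norm_nonneg _) (by
          rw [← hn]; exact hf.norm_le htw)
      refine le_trans ?_ h
      have hd := hf.norm_deriv_le htw
      rw [hn] at hd
      have hden : 1 - t * ‖w‖ ≤ ‖1 - (t : ℂ) * w‖ := by
        have := norm_sub_norm_le (1 : ℂ) (t * w)
        rwa [norm_one, hn] at this
      rw [norm_div, norm_div, div_mul_eq_mul_div, ← add_div]
      have h1σ : 0 < 1 - t * ‖w‖ := by linarith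
      have hle : ‖f (t * w)‖ + ‖deriv f (t * w)‖ * φ ≤
          ‖f (t * w)‖ + φ * ((1 - ‖f (t * w)‖ ^ 2) / (1 - (t * ‖w‖) ^ 2)) := by
        rw [mul_comm _ φ]
        gcongr
      exact div_le_div₀ (le_trans (by positivity) hle) hle h1σ hden

lemma ClassB.summable_norm_coeff_mul_phi {f : ℂ → ℂ} (hf : ClassB f) {r : ℝ}
    (hr : r ∈ Ico (0 : ℝ) 1) : Summable fun k : ℕ => ‖coeff f (k + 2)‖ * phi (k + 2) r :=
  Summable.of_nonneg_of_le (fun _ => mul_nonneg (norm_nonneg _) (phi_nonneg _ hr.1))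
    (fun _ => mul_le_mul_of_nonneg_right (hf.norm_coeff_le (by omega)) (phi_nonneg _ hr.1))
    ((hasSum_phi hr).summable.mul_left _)

lemma phi_zero_right {k : ℕ} (hk : k ≠ 0) : phi k 0 = 0 := by simp [phi, hk]

lemma logBound_eq {x : ℝ} (hx : x ∈ Ioo (0 : ℝ) 1) : logBound x = -Real.log (1 - x) / x := by
  rw [logBound, if_neg hx.1.ne', one_div (1 - x), Real.log_inv]
  ring

lemma bohrSum_le_logBound {m : ℕ} (hm : 1 ≤ m) {f ω : ℂ → ℂ} (hf : ClassB f)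
    (hω : ClassBm m ω) {z : ℂ} (hz : ‖z‖ < 1) (hφ : 2 * phi 1 (‖z‖ ^ m) ≤ 1 - (‖z‖ ^ m) ^ 2)
    (hPhi : z ≠ 0 → Phi m ‖z‖ ≤ 0) : bohrSum m f ω z ≤ logBound (‖z‖ ^ m) := by
  have hm0 : m ≠ 0 := by omega
  -- At `z = 0` only `|f(0)| ≤ 1` remains; the formula for `Φ_m` divides by `r ^ m` and is not used
  -- there.
  rcases eq_or_ne z 0 with rfl | hz0
  · have h0 : ω 0 = 0 := by simpa [hm0] using hω.norm_le_pow hm zero_mem_unitDisk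
    have h1 : cesaro f 0 = f 0 := by
      rw [cesaro, tsum_eq_single 0 fun n hn => by simp [cesaroTerm, hn]]
      simp [cesaroTerm, coeff_zero]
    have h2 : ∀ k, phi (k + 2) 0 = 0 := fun k => phi_zero_right (by omega)
    simp only [bohrSum, h0, norm_zero, zero_pow hm0, h2, mul_zero, tsum_zero, add_zero,
      phi_zero_right one_ne_zero, h1, logBound, if_true]
    exact hf.2 0 zero_mem_unitDisk
  · set r := ‖z‖
    have hr : r ∈ Ioo (0 : ℝ) 1 := ⟨norm_pos_iff.2 hz0, hz⟩
    have hx : r ^ m ∈ Ioo (0 : ℝ) 1 := ⟨pow_pos hr.1 m, pow_lt_one₀ hr.1.le hr.2 hm0⟩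
    have hA := hf.2 0 zero_mem_unitDisk
    have hA0 := norm_nonneg (f 0)
    have h1 := hf.norm_cesaro_add_le hx (hω.norm_le_pow hm (mem_unitDisk.2 hz))
      (phi_nonneg 1 hx.1.le) hφ
    have hrI : r ∈ Ico (0 : ℝ) 1 := ⟨hr.1.le, hr.2⟩
    have hN := (hasSum_phi hrI).summable
    have h2 : ∑' k, ‖coeff f (k + 2)‖ * phi (k + 2) r ≤
        (1 - ‖f 0‖ ^ 2) * ∑' k, phi (k + 2) r := by
      rw [← tsum_mul_left]
      exact (hf.summable_norm_coeff_mul_phi hrI).tsum_le_tsum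
        (fun _ => mul_le_mul_of_nonneg_right (hf.norm_coeff_le (by omega)) (phi_nonneg _ hr.1.le))
        (hN.mul_left _)
    have hN0 : 0 ≤ ∑' k, phi (k + 2) r := tsum_nonneg fun _ => phi_nonneg _ hr.1.le
    have h3 := hPhi hz0
    rw [Phi_eq hm hr] at h3
    rw [bohrSum, logBound_eq hx]
    have h4 : (1 - ‖f 0‖ ^ 2) * ∑' k, phi (k + 2) r ≤
        (1 - ‖f 0‖) * (2 * ∑' k, phi (k + 2) r) := by
      nlinarith [mul_nonneg (mul_nonneg (sub_nonneg.2 hA) (sub_nonneg.2 hA)) hN0]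
    nlinarith [mul_nonneg (sub_nonneg.2 hA) (neg_nonneg.2 h3)]

/-! ### Sharpness: the Möbius functions -/

lemma one_add_ofReal_mul_ne_zero {a : ℝ} (ha : a ∈ Ioo (0 : ℝ) 1) {z : ℂ} (hz : z ∈ unitDisk) :
    1 + (a : ℂ) * z ≠ 0 := by
  have h := one_sub_ofReal_mul_ne_zero ⟨ha.1.le, ha.2.le⟩
    (w := -z) (mem_unitDisk.2 (by rw [norm_neg]; exact mem_unitDisk.1 hz))
  simpa using h

lemma classB_moebius {a : ℝ} (ha : a ∈ Ioo (0 : ℝ) 1) : ClassB (moebius a) := by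
  constructor
  · exact DifferentiableOn.div (by fun_prop) (by fun_prop)
      fun z hz => one_add_ofReal_mul_ne_zero ha hz
  · intro z hz
    have hz1 := mem_unitDisk.1 hz
    have h := norm_sub_le_norm_one_sub_conj_mul (u := z) (v := -(a : ℂ)) hz1.le (by
      rw [norm_neg, Complex.norm_real, Real.norm_eq_abs, abs_of_pos ha.1]
      exact ha.2.le)
    rw [moebius, norm_div, div_le_one (norm_pos_iff.2 (one_add_ofReal_mul_ne_zero ha hz))]
    simpa [add_comm] using h

lemma classBm_pow (m : ℕ) : ClassBm m fun z : ℂ => z ^ m := by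
  refine ⟨⟨by fun_prop, fun z hz => ?_⟩, fun k hk => ?_, ?_⟩
  · rw [norm_pow]
    exact pow_le_one₀ (norm_nonneg z) (mem_unitDisk.1 hz).le
  · rw [iteratedDeriv_fun_pow_zero, if_neg (by omega), Nat.cast_zero]
  · rw [iteratedDeriv_fun_pow_zero, if_pos rfl]
    exact_mod_cast m.factorial_ne_zero

lemma deriv_moebius {a : ℝ} (ha : a ∈ Ioo (0 : ℝ) 1) {z : ℂ} (hz : z ∈ unitDisk) :
    deriv (moebius a) z = (1 - (a : ℂ) ^ 2) / (1 + a * z) ^ 2 := by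
  have h := (((hasDerivAt_id z).const_add (a : ℂ)).div
    (((hasDerivAt_id z).const_mul (a : ℂ)).const_add 1)
      (one_add_ofReal_mul_ne_zero ha hz)).deriv
  refine h.trans ?_
  simp
  ring

lemma iteratedDeriv_moebius {a : ℝ} (ha : a ∈ Ioo (0 : ℝ) 1) (k : ℕ) :
    ∀ z ∈ unitDisk, iteratedDeriv (k + 1) (moebius a) z =
      (1 - (a : ℂ) ^ 2) * (-a) ^ k * ((k + 1).factorial : ℂ) / (1 + a * z) ^ (k + 2) := by
  induction k with
  | zero =>
    intro z hz
    simp [iteratedDeriv_one, deriv_moebius ha hz]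
  | succ k ih =>
    intro z hz
    have hne := one_add_ofReal_mul_ne_zero ha hz
    have hev : iteratedDeriv (k + 1) (moebius a) =ᶠ[𝓝 z] fun z =>
        (1 - (a : ℂ) ^ 2) * (-a) ^ k * ((k + 1).factorial : ℂ) / (1 + a * z) ^ (k + 2) := by
      filter_upwards [isOpen_unitDisk.mem_nhds hz] with y hy using ih y hy
    have h1 : HasDerivAt (fun z : ℂ => 1 + (a : ℂ) * z) a z := by
      simpa using ((hasDerivAt_id z).const_mul (a : ℂ)).const_add 1
    have h2 := ((hasDerivAt_const z
      ((1 - (a : ℂ) ^ 2) * (-a) ^ k * ((k + 1).factorial : ℂ))).div (h1.pow (k + 2))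
        (pow_ne_zero _ hne)).deriv
    rw [iteratedDeriv_succ, hev.deriv_eq]
    refine h2.trans ?_
    rw [Nat.factorial_succ (k + 1)]
    push_cast
    simp only [Pi.pow_apply]
    rw [zero_mul, zero_sub]
    field_simp
    ring

lemma norm_coeff_moebius {a : ℝ} (ha : a ∈ Ioo (0 : ℝ) 1) (k : ℕ) :
    ‖coeff (moebius a) (k + 1)‖ = (1 - a ^ 2) * a ^ k := by
  have hf : ((k + 1).factorial : ℂ) ≠ 0 := by exact_mod_cast (k + 1).factorial_ne_zero
  have h0 : 0 ≤ 1 - a ^ 2 := by nlinarith [ha.1, ha.2]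
  rw [coeff, iteratedDeriv_moebius ha k 0 zero_mem_unitDisk, mul_zero, add_zero, one_pow, div_one,
    mul_div_cancel_right₀ _ hf, norm_mul, norm_pow, norm_neg, Complex.norm_real,
    Real.norm_eq_abs, abs_of_pos ha.1, ← Complex.ofReal_pow, ← Complex.ofReal_one,
    ← Complex.ofReal_sub, Complex.norm_real, Real.norm_eq_abs, abs_of_nonneg h0]

lemma ofReal_mem_unitDisk {x : ℝ} (hx : x ∈ Ioo (0 : ℝ) 1) : (x : ℂ) ∈ unitDisk := by
  rw [mem_unitDisk, Complex.norm_real, Real.norm_eq_abs, abs_of_pos hx.1]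
  exact hx.2

/-- A function whose values at `t x` are the real numbers `g t` has a Cesàro transform at `x` of
modulus at least `∫₀¹ g t / (1 - t x) dt`. -/
lemma integral_le_norm_cesaro {f : ℂ → ℂ} (hf : DifferentiableOn ℂ f unitDisk) {x : ℝ}
    (hx : x ∈ Ioo (0 : ℝ) 1) {g : ℝ → ℝ} (hg : ∀ t ∈ Icc (0 : ℝ) 1, f (t * x) = g t) :
    ∫ t in (0 : ℝ)..1, g t / (1 - t * x) ≤ ‖cesaro f x‖ := by
  have h : cesaro f x = ((∫ t in (0 : ℝ)..1, g t / (1 - t * x) : ℝ) : ℂ) := by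
    rw [cesaro_eq_integral hf (ofReal_mem_unitDisk hx), ← intervalIntegral.integral_ofReal]
    refine intervalIntegral.integral_congr fun t ht => ?_
    rw [uIcc_of_le zero_le_one] at ht
    simp only [hg t ht]
    push_cast
    rfl
  rw [h, Complex.norm_real]
  exact Real.le_norm_self _

/-- On the positive axis the Möbius function attains the growth and Schwarz–Pick bounds, so
`integrand_identity` gives the integrand exactly. Replacing `1 + a s` by `1 + s` costs at most `1 -
a` inside a bracket already multiplied by `1 - a`. -/
lemma le_norm_cesaro_moebius {a : ℝ} (ha : a ∈ Ioo (0 : ℝ) 1) {x φ : ℝ}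
    (hx : x ∈ Ioo (0 : ℝ) 1) (hφ : 0 ≤ φ) :
    -Real.log (1 - x) / x + (1 - a) * (-logMean x - (1 - a) + φ * ((1 + a) / 2 * kernelMean x)) ≤
      ‖cesaro (moebius a) x‖ + ‖cesaro (deriv (moebius a)) x‖ * φ := by
  have hx' : x ∈ Ico (0 : ℝ) 1 := ⟨hx.1.le, hx.2⟩
  have hB := classB_moebius ha
  have hd : ∀ t ∈ Icc (0 : ℝ) 1, 0 < 1 + a * (t * x) := fun t ht => by
    have := mul_nonneg ha.1.le (mul_nonneg ht.1 hx.1.le)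
    linarith
  have hs : ∀ t ∈ Icc (0 : ℝ) 1, 0 < 1 - t * x := fun t ht => one_sub_mul_pos ht hx'
  have h1 := integral_le_norm_cesaro hB.1 hx
    (g := fun t => (a + t * x) / (1 + a * (t * x))) fun t _ => by simp [moebius]
  have h2 := integral_le_norm_cesaro (differentiableOn_deriv hB.1) hx
    (g := fun t => (1 - a ^ 2) / (1 + a * (t * x)) ^ 2) fun t ht => by
      rw [deriv_moebius ha (ofReal_mul_mem_unitDisk ht (ofReal_mem_unitDisk hx))]
      push_cast
      rfl
  have hi1 : IntervalIntegrable (fun t => (a + t * x) / (1 + a * (t * x)) / (1 - t * x))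
      MeasureTheory.volume 0 1 :=
    intervalIntegrable_of_Icc <| ContinuousOn.div (ContinuousOn.div (by fun_prop) (by fun_prop)
      fun t ht => (hd t ht).ne') (by fun_prop) fun t ht => (hs t ht).ne'
  have hi2 : IntervalIntegrable (fun t => (1 - a ^ 2) / (1 + a * (t * x)) ^ 2 / (1 - t * x))
      MeasureTheory.volume 0 1 :=
    intervalIntegrable_of_Icc <| ContinuousOn.div (ContinuousOn.div (by fun_prop) (by fun_prop)
      fun t ht => (pow_pos (hd t ht) 2).ne') (by fun_prop) fun t ht => (hs t ht).ne'
  refine le_trans ?_ (add_le_add h1 (mul_le_mul_of_nonneg_right h2 hφ))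
  rw [← integral_majorant hx, ← intervalIntegral.integral_mul_const,
    ← intervalIntegral.integral_add hi1 (hi2.mul_const φ)]
  refine intervalIntegral.integral_mono_on zero_le_one (intervalIntegrable_majorant hx _ _ _ _)
    (hi1.add (hi2.mul_const φ)) fun t ht => ?_
  have hdt := hd t ht
  have hst := hs t ht
  have hs0 := mul_nonneg ht.1 hx.1.le
  have ha0 := ha.1
  have ha1 : 0 < 1 - a := sub_pos.2 ha.2
  generalize t * x = s at *
  have hid := integrand_identity (A := a) (φ := φ) hdt.ne' hst.ne'
  have hlhs : (a + s) / (1 + a * s) / (1 - s) + (1 - a ^ 2) / (1 + a * s) ^ 2 / (1 - s) * φ =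
      ((a + s) / (1 + a * s) + φ * ((1 - a ^ 2) / (1 + a * s) ^ 2)) / (1 - s) := by ring
  rw [hlhs, hid]
  refine add_le_add_right (mul_le_mul_of_nonneg_left (add_le_add ?_ ?_) ha1.le) _
  · have : 1 / (1 + a * s) - 1 / (1 + s) = (1 - a) * (s / ((1 + a * s) * (1 + s))) := by
      field_simp
      ring
    have h3 : s / ((1 + a * s) * (1 + s)) ≤ 1 := by
      rw [div_le_one (by positivity)]
      nlinarith [mul_nonneg ha0.le hs0, mul_nonneg (mul_nonneg ha0.le hs0) hs0]
    nlinarith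
  · refine mul_le_mul_of_nonneg_left ?_ hφ
    rw [← mul_div_assoc, div_mul_cancel₀ _ two_ne_zero]
    have h4 : a * s ≤ s := mul_le_of_le_one_left hs0 ha.2.le
    gcongr

lemma tendsto_tsum_pow_mul_phi {r : ℝ} (hr : r ∈ Ico (0 : ℝ) 1) :
    Tendsto (fun a : ℝ => ∑' k, a ^ (k + 1) * phi (k + 2) r) (𝓝[<] 1)
      (𝓝 (∑' k, phi (k + 2) r)) := by
  refine tendsto_tsum_of_dominated_convergence (hasSum_phi hr).summable (fun k => ?_) ?_
  · have : Continuous fun a : ℝ => a ^ (k + 1) * phi (k + 2) r := by fun_prop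
    simpa using (this.tendsto 1).mono_left nhdsWithin_le_nhds
  · filter_upwards [Ioo_mem_nhdsLT (zero_lt_one' ℝ)] with a ha k
    have h := phi_nonneg (k + 2) hr.1
    rw [norm_mul, norm_pow, Real.norm_of_nonneg ha.1.le, Real.norm_of_nonneg h]
    exact mul_le_of_le_one_left h (pow_le_one₀ ha.1.le ha.2.le)

lemma exists_logBound_lt_bohrSum {m : ℕ} (hm : 1 ≤ m) {r : ℝ} (hr : r ∈ Ioo (0 : ℝ) 1)
    (hPhi : 0 < Phi m r) : ∃ a₀ ∈ Ioo (0 : ℝ) 1, ∀ a ∈ Ioo a₀ 1,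
      logBound (r ^ m) < bohrSum m (moebius a) (fun z : ℂ => z ^ m) (r : ℂ) := by
  have hx : r ^ m ∈ Ioo (0 : ℝ) 1 := ⟨pow_pos hr.1 m, pow_lt_one₀ hr.1.le hr.2 (by omega)⟩
  have hrI : r ∈ Ico (0 : ℝ) 1 := ⟨hr.1.le, hr.2⟩
  rw [Phi_eq hm hr] at hPhi
  -- The excess of the Bohr sum is at least `1 - a` times this function, since `1 - a² = (1 - a) (1
  -- + a)`; its limit is `Φ_m(r) > 0`.
  have hlim : Tendsto (fun a : ℝ => -logMean (r ^ m) - (1 - a) +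
      phi 1 (r ^ m) * ((1 + a) / 2 * kernelMean (r ^ m)) +
      (1 + a) * ∑' k, a ^ (k + 1) * phi (k + 2) r) (𝓝[<] 1)
      (𝓝 (-logMean (r ^ m) - (1 - 1) + phi 1 (r ^ m) * ((1 + 1) / 2 * kernelMean (r ^ m)) +
        (1 + 1) * ∑' k, phi (k + 2) r)) := by
    have ha : Tendsto (fun a : ℝ => a) (𝓝[<] 1) (𝓝 1) := nhdsWithin_le_nhds
    exact ((tendsto_const_nhds.sub (ha.const_sub 1)).add
      ((((ha.const_add 1).div_const 2).mul_const _).const_mul _)).add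
        ((ha.const_add 1).mul (tendsto_tsum_pow_mul_phi hrI))
  have hev := hlim.eventually (lt_mem_nhds (b := _) (a := (0 : ℝ)) (by
    norm_num
    linarith))
  obtain ⟨l, hl, hl'⟩ := (mem_nhdsLT_iff_exists_Ioo_subset' (zero_lt_one' ℝ)).1 hev
  -- The left endpoint `l` may be negative; the maximum with `1 / 2` forces the threshold into `(0,
  -- 1)`.
  refine ⟨max l (1 / 2), ⟨by positivity, max_lt hl (by norm_num)⟩, fun a ha => ?_⟩
  have haI : a ∈ Ioo (0 : ℝ) 1 :=
    ⟨by linarith [(le_max_right l (1 / 2)).trans_lt ha.1], ha.2⟩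
  have hpos := hl' ⟨(le_max_left l (1 / 2)).trans_lt ha.1, ha.2⟩
  have h1 := le_norm_cesaro_moebius haI hx (phi_nonneg 1 hx.1.le)
  have h2 : ∑' k, ‖coeff (moebius a) (k + 2)‖ * phi (k + 2) r =
      (1 - a ^ 2) * ∑' k, a ^ (k + 1) * phi (k + 2) r := by
    rw [← tsum_mul_left]
    exact tsum_congr fun k => by rw [norm_coeff_moebius haI (k + 1), mul_assoc]
  have hn : ‖(r : ℂ)‖ = r := by rw [Complex.norm_real, Real.norm_of_nonneg hr.1.le]
  rw [bohrSum, hn, h2, logBound_eq hx, ← Complex.ofReal_pow]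
  have h3 := mul_pos (sub_pos.2 haI.2) (show 0 < _ from hpos)
  nlinarith

end CesaroBohr

theorem theorem2 (m : ℕ) (hm : 1 ≤ m) :
    ∃ Rm Rm1 : ℝ,
      -- `Rm` is the unique root in `(0, 1)` of the first equation
      (Rm ∈ Set.Ioo (0 : ℝ) 1 ∧ CesaroBohr.RmEquation m Rm ∧
        ∀ s ∈ Set.Ioo (0 : ℝ) 1, CesaroBohr.RmEquation m s → s = Rm) ∧
      -- `Rm1` is the unique root in `(0, 1)` of `Φ_m`
      (Rm1 ∈ Set.Ioo (0 : ℝ) 1 ∧ CesaroBohr.Phi m Rm1 = 0 ∧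
        ∀ s ∈ Set.Ioo (0 : ℝ) 1, CesaroBohr.Phi m s = 0 → s = Rm1) ∧
      Rm1 ≤ Rm ∧
      -- the inequality, with convergence of the series in it
      (∀ f ω : ℂ → ℂ, CesaroBohr.ClassB f → CesaroBohr.ClassBm m ω →
        ∀ z : ℂ, ‖z‖ ≤ Rm1 →
          Summable (CesaroBohr.cesaroTerm f (ω z)) ∧
          Summable (CesaroBohr.cesaroTerm (deriv f) (ω z)) ∧
          Summable (fun k : ℕ =>
            ‖CesaroBohr.coeff f (k + 2)‖ * CesaroBohr.phi (k + 2) ‖z‖) ∧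
          CesaroBohr.bohrSum m f ω z ≤ CesaroBohr.logBound (‖z‖ ^ m)) ∧
      -- `Rm1` cannot be replaced by any larger number
      (∀ r ∈ Set.Ioo Rm1 1, ∃ a₀ ∈ Set.Ioo (0 : ℝ) 1, ∀ a ∈ Set.Ioo a₀ 1,
        CesaroBohr.ClassB (CesaroBohr.moebius a) ∧
        CesaroBohr.ClassBm m (fun z : ℂ => z ^ m) ∧
        CesaroBohr.logBound (r ^ m)
          < CesaroBohr.bohrSum m (CesaroBohr.moebius a) (fun z : ℂ => z ^ m) (r : ℂ)) := by
  obtain ⟨R, R1, hR, hR1, hle⟩ := CesaroBohr.exists_radii hm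
  refine ⟨R, R1, hR, hR1, hle, fun f ω hf hω z hz => ?_, fun r hr => ?_⟩
  · have hz1 : ‖z‖ < 1 := hz.trans_lt hR1.1.2
    have hω1 : ω z ∈ CesaroBohr.unitDisk := CesaroBohr.mem_unitDisk.2
      ((hω.norm_le_pow hm (CesaroBohr.mem_unitDisk.2 hz1)).trans_lt
        (pow_lt_one₀ (norm_nonneg z) hz1 (by omega)))
    refine ⟨(CesaroBohr.hasSum_cesaroTerm hf.1 hω1).summable,
      (CesaroBohr.hasSum_cesaroTerm (CesaroBohr.differentiableOn_deriv hf.1) hω1).summable,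
      hf.summable_norm_coeff_mul_phi ⟨norm_nonneg z, hz1⟩,
      CesaroBohr.bohrSum_le_logBound hm hf hω hz1 ?_ fun hz0 => ?_⟩
    -- Here `R_{m,1} ≤ R_m` enters: `2 φ₁(r ^ m) ≤ 2 φ₁(R_m ^ m) = 1 - (R_m ^ m)² ≤ 1 - (r ^ m)²`.
    · have h1 := (CesaroBohr.RmEquation_iff hm hR.1).1 hR.2.1
      have h2 : ‖z‖ ^ m ≤ R ^ m := pow_le_pow_left₀ (norm_nonneg z) (hz.trans hle) m
      have h3 : 0 ≤ ‖z‖ ^ m := by positivity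
      have h4 := CesaroBohr.phi_mono 1 h3 h2 (pow_lt_one₀ hR.1.1.le hR.1.2 (by omega))
      nlinarith
    · rcases hz.lt_or_eq with h | h
      · exact hR1.2.1 ▸ (CesaroBohr.Phi_strictMono hm (norm_pos_iff.2 hz0) h hR1.1.2).le
      · rw [h, hR1.2.1]
  · have hr0 : 0 < r := hR1.1.1.trans hr.1
    have hPhi : 0 < CesaroBohr.Phi m r :=
      hR1.2.1 ▸ CesaroBohr.Phi_strictMono hm hR1.1.1 hr.1 hr.2
    obtain ⟨a₀, ha₀, h⟩ := CesaroBohr.exists_logBound_lt_bohrSum hm ⟨hr0, hr.2⟩ hPhi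
    exact ⟨a₀, ha₀, fun a ha =>
      ⟨CesaroBohr.classB_moebius ⟨ha₀.1.trans ha.1, ha.2⟩, CesaroBohr.classBm_pow m, h a ha⟩⟩
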